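/- Let $n\ge 0$ and $m\ge 1$ be integers, $G=\mathrm{GL}(n,\mathbb C)$ regarded as a real Lie group, $K=\mathrm U(n)$, $\mathfrak g_0=\mathfrak{gl}(n,\mathbb C)$ and $\mathfrak g=\mathfrak g_0\otimes_{\mathbb R}\mathbb C$, where $j$ denotes the complex structure of $\mathfrak g$. Let $\phi^L,\phi^R:\mathfrak g_0\to\mathfrak g$ be the complex Lie algebra embeddings $\phi^L(E)=\frac12(E-j\,iE)$, $\phi^R(E)=\frac12(\bar E+j\,i\bar E)$, and write $(E,E')=\phi^L(E)+\phi^R(E')$. Harish-Chandra modules are admissible $(\mathfrak g,K)$-modules. For a weight $\lambda=(\lambda_L,\lambda_R)\in\mathbb C^n\times\mathbb C^n$ (in the coordinates given by $\phi^L,\phi^R$ on the diagonal Cartan subalgebra) let $\mathcal{HC}_\lambda$ be the category of $Z(\mathfrak g)$-finite Harish-Chandra modules with generalized infinitesimal character $\chi_\lambda$. Let $V=\mathbb C^n$ be the conjugate standard representation, on which $g\in G$ acts by the matrix $\bar g$. For $r\ge 0$ let $\mathbb H_r$ be the graded Hecke algebra over $\mathbb C$ with generators $y_1,\dots,y_r$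 and $s_1,\dots,s_{r-1}$, where the $y_i$ commute, the $s_i$ satisfy the Coxeter relations of the symmetric group $S_r$, $s_iy_i-y_{i+1}s_i=1$, and $s_iy_j=y_js_i$ for $j\ne i,i+1$; let $\mathbb H_r\text{-}\mathrm{Mod}$ be the category of its finite-dimensional modules. Let $\mathrm{For}:\mathbb H_m\text{-}\mathrm{Mod}\to\mathbb H_{m-1}\text{-}\mathrm{Mod}$ be restriction along the homomorphism $\mathbb H_{m-1}\to\mathbb H_m$, $y_i\mapsto y_{i+1}$, $s_i\mapsto s_{i+1}$. For a Harish-Chandra module $X$ let $\Gamma_{n,r}(X)=(X\otimes V^{\otimes r})^K$ be the $\mathbb H_r$-module on which the generators act by the restrictions of the following operators on $X\otimes V^{\otimes r}$, whose factors are numbered $0,1,\dots,r$ and where $A^{(x)}$ denotes the action of $A\in\mathfrak g$ on the $x$-th factor: $$s_k=-\sum_{i,j=1}^n (0,E_{i,j})^{(k)}(0,E_{j,i})^{(k+1)},\qquad y_l=\sum_{0\le x<l}\ \sum_{i,j=1}^n (0,E_{i,j})^{(x)}(0,E_{j,i})^{(l)}+\frac n2 .$$ This defines a functor $\Gamma_{n,r}$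 from Harish-Chandra modules to $\mathbb H_r\text{-}\mathrm{Mod}$, which acts on a morphism $f$ by $f\otimes\mathrm{id}$. Then, as functors $\mathcal{HC}_\lambda\to\mathbb H_{m-1}\text{-}\mathrm{Mod}$, $\Gamma_{n,m-1}\circ(-\otimes V)$ coincides with $\mathrm{For}\circ\Gamma_{n,m}$ under the canonical identification $(X\otimes V)\otimes V^{\otimes(m-1)}=X\otimes V^{\otimes m}$. Explicitly, for every $X\in\mathcal{HC}_\lambda$ this identification maps $((X\otimes V)\otimes V^{\otimes(m-1)})^K$ onto $(X\otimes V^{\otimes m})^K$ and carries the $\mathbb H_{m-1}$-action on $\Gamma_{n,m-1}(X\otimes V)$ to that on $\mathrm{For}(\Gamma_{n,m}(X))$; and these maps form a natural isomorphism of functors. -/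

import Mathlib

open scoped TensorProduct Matrix ComplexConjugate
open CategoryTheory

attribute [local instance 100] LieRing.ofAssociativeRing

noncomputable section

namespace GLnHecke

universe u

/-! ### The graded Hecke algebra -/

/-- Generators of the graded Hecke algebra of type A. The indices start from `0`, so `y i`
stands for `y_{i+1}` and `s i` for the adjacent swap `s_{i+1} = (i+1, i+2)`. -/
inductive HeckeGen (m : ℕ) : Type
  | y (i : Fin m) : HeckeGen m
  | s (i : ℕ) (hi : i + 1 < m) : HeckeGen m

/-- The free generator attached to `y i`. -/
def freeY {m : ℕ} (i : Fin m) : FreeAlgebra ℂ (HeckeGen m) := FreeAlgebra.ι ℂ (HeckeGen.y i)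

/-- The free generator attached to `s i`. -/
def freeS {m : ℕ} (i : ℕ) (hi : i + 1 < m) : FreeAlgebra ℂ (HeckeGen m) :=
  FreeAlgebra.ι ℂ (HeckeGen.s i hi)

/-- Defining relations: the `y i` commute, the `s i` satisfy the Coxeter relations of the symmetric
group, `s_i y_i - y_{i+1} s_i = 1`, and `s_i y_j = y_j s_i` for `j ≠ i, i+1`. -/
inductive HeckeRel (m : ℕ) : FreeAlgebra ℂ (HeckeGen m) → FreeAlgebra ℂ (HeckeGen m) → Prop
  | y_comm (i j : Fin m) : HeckeRel m (freeY i * freeY j) (freeY j * freeY i)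
  | s_sq (i : ℕ) (hi : i + 1 < m) : HeckeRel m (freeS i hi * freeS i hi) 1
  | braid (i : ℕ) (hi : i + 1 < m) (hi2 : i + 1 + 1 < m) :
      HeckeRel m (freeS i hi * freeS (i + 1) hi2 * freeS i hi)
        (freeS (i + 1) hi2 * freeS i hi * freeS (i + 1) hi2)
  | s_comm (i j : ℕ) (hi : i + 1 < m) (hj : j + 1 < m) (hij : i + 1 < j) :
      HeckeRel m (freeS i hi * freeS j hj) (freeS j hj * freeS i hi)
  | cross (i : ℕ) (hi : i + 1 < m) :
      HeckeRel m (freeS i hi * freeY ⟨i, Nat.lt_of_succ_lt hi⟩ - freeY ⟨i + 1, hi⟩ * freeS i hi) 1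
  | s_y_comm (i : ℕ) (hi : i + 1 < m) (j : Fin m) (h1 : (j : ℕ) ≠ i) (h2 : (j : ℕ) ≠ i + 1) :
      HeckeRel m (freeS i hi * freeY j) (freeY j * freeS i hi)

/-- The graded Hecke algebra `ℍ_m`. -/
def Hecke (m : ℕ) : Type := RingQuot (HeckeRel m)

instance (m : ℕ) : Ring (Hecke m) := inferInstanceAs (Ring (RingQuot (HeckeRel m)))

instance (m : ℕ) : Algebra ℂ (Hecke m) := inferInstanceAs (Algebra ℂ (RingQuot (HeckeRel m)))

/-- The quotient map from the free algebra. -/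
def Hecke.mk (m : ℕ) : FreeAlgebra ℂ (HeckeGen m) →ₐ[ℂ] Hecke m :=
  RingQuot.mkAlgHom ℂ (HeckeRel m)

/-- The element `y_{i+1}` of `ℍ_m`. -/
def Hecke.y {m : ℕ} (i : Fin m) : Hecke m := Hecke.mk m (freeY i)

/-- The element `s_{i+1}` of `ℍ_m`. -/
def Hecke.s {m : ℕ} (i : ℕ) (hi : i + 1 < m) : Hecke m := Hecke.mk m (freeS i hi)

theorem Hecke.mk_surjective (m : ℕ) : Function.Surjective (Hecke.mk m) :=
  RingQuot.mkAlgHom_surjective ℂ (HeckeRel m)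

theorem Hecke.mk_rel {m : ℕ} {a b : FreeAlgebra ℂ (HeckeGen m)} (h : HeckeRel m a b) :
    Hecke.mk m a = Hecke.mk m b := RingQuot.mkAlgHom_rel ℂ h

/-- A choice of images of the generators that respects the relations. -/
structure HeckeDatum (m : ℕ) (R : Type*) [Ring R] [Algebra ℂ R] where
  y : Fin m → R
  s : (i : ℕ) → i + 1 < m → R
  y_comm : ∀ i j, y i * y j = y j * y i
  s_sq : ∀ i hi, s i hi * s i hi = 1
  braid : ∀ i hi hi2, s i hi * s (i + 1) hi2 * s i hi = s (i + 1) hi2 * s i hi * s (i + 1) hi2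
  s_comm : ∀ i j hi hj, i + 1 < j → s i hi * s j hj = s j hj * s i hi
  cross : ∀ i hi, s i hi * y ⟨i, Nat.lt_of_succ_lt hi⟩ - y ⟨i + 1, hi⟩ * s i hi = 1
  s_y_comm : ∀ i hi (j : Fin m), (j : ℕ) ≠ i → (j : ℕ) ≠ i + 1 → s i hi * y j = y j * s i hi

/-- The image of a generator. -/
def HeckeDatum.gen {m : ℕ} {R : Type*} [Ring R] [Algebra ℂ R] (D : HeckeDatum m R) :
    HeckeGen m → R
  | .y i => D.y i
  | .s i hi => D.s i hi

/-- The algebra map out of `ℍ_m` given by images of the generators. -/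
def HeckeDatum.lift {m : ℕ} {R : Type*} [Ring R] [Algebra ℂ R] (D : HeckeDatum m R) :
    Hecke m →ₐ[ℂ] R :=
  RingQuot.liftAlgHom ℂ ⟨FreeAlgebra.lift ℂ D.gen, by
    intro a b h
    induction h with
    | y_comm i j => simpa [freeY, HeckeDatum.gen] using D.y_comm i j
    | s_sq i hi => simpa [freeS, HeckeDatum.gen] using D.s_sq i hi
    | braid i hi hi2 => simpa [freeS, HeckeDatum.gen] using D.braid i hi hi2
    | s_comm i j hi hj hij => simpa [freeS, HeckeDatum.gen] using D.s_comm i j hi hj hij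
    | cross i hi => simpa [freeS, freeY, HeckeDatum.gen] using D.cross i hi
    | s_y_comm i hi j h1 h2 =>
      simpa [freeS, freeY, HeckeDatum.gen] using D.s_y_comm i hi j h1 h2⟩

theorem HeckeDatum.lift_mk {m : ℕ} {R : Type*} [Ring R] [Algebra ℂ R] (D : HeckeDatum m R)
    (a : FreeAlgebra ℂ (HeckeGen m)) : D.lift (Hecke.mk m a) = FreeAlgebra.lift ℂ D.gen a :=
  RingQuot.liftAlgHom_mkAlgHom_apply ..

theorem HeckeDatum.lift_y {m : ℕ} {R : Type*} [Ring R] [Algebra ℂ R] (D : HeckeDatum m R)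
    (i : Fin m) : D.lift (Hecke.y i) = D.y i := by
  simp [Hecke.y, HeckeDatum.lift_mk, freeY, HeckeDatum.gen]

theorem HeckeDatum.lift_s {m : ℕ} {R : Type*} [Ring R] [Algebra ℂ R] (D : HeckeDatum m R)
    (i : ℕ) (hi : i + 1 < m) : D.lift (Hecke.s i hi) = D.s i hi := by
  simp [Hecke.s, HeckeDatum.lift_mk, freeS, HeckeDatum.gen]

/-- An element commuting with the images of the generators commutes with the whole image. -/
theorem HeckeDatum.lift_commute {m : ℕ} {R : Type*} [Ring R] [Algebra ℂ R] (D : HeckeDatum m R)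
    (r : R) (hy : ∀ i, Commute r (D.y i)) (hs : ∀ i hi, Commute r (D.s i hi)) (h : Hecke m) :
    Commute r (D.lift h) := by
  obtain ⟨a, rfl⟩ := Hecke.mk_surjective m h
  rw [HeckeDatum.lift_mk]
  induction a using FreeAlgebra.induction with
  | grade0 c => rw [AlgHom.commutes]; exact (Algebra.commutes c r).symm
  | grade1 g =>
    rw [FreeAlgebra.lift_ι_apply]
    cases g with
    | y i => exact hy i
    | s i hi => exact hs i hi
  | mul a b ha hb => rw [map_mul]; exact ha.mul_right hb
  | add a b ha hb => rw [map_add]; exact ha.add_right hb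

/-- The shifted embedding `ℍ_m → ℍ_{m+1}`, `y_i ↦ y_{i+1}`, `s_i ↦ s_{i+1}`. -/
def Hecke.shift (m : ℕ) : Hecke m →ₐ[ℂ] Hecke (m + 1) :=
  HeckeDatum.lift
    { y := fun i => Hecke.y i.succ
      s := fun i hi => Hecke.s (i + 1) (Nat.succ_lt_succ hi)
      y_comm := fun i j => by
        simpa [Hecke.y] using Hecke.mk_rel (.y_comm i.succ j.succ)
      s_sq := fun i hi => by
        simpa [Hecke.s] using Hecke.mk_rel (.s_sq (i + 1) (Nat.succ_lt_succ hi))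
      braid := fun i hi hi2 => by
        simpa [Hecke.s] using
          Hecke.mk_rel (.braid (i + 1) (Nat.succ_lt_succ hi) (Nat.succ_lt_succ hi2))
      s_comm := fun i j hi hj hij => by
        simpa [Hecke.s] using Hecke.mk_rel
          (.s_comm (i + 1) (j + 1) (Nat.succ_lt_succ hi) (Nat.succ_lt_succ hj)
            (Nat.succ_lt_succ hij))
      cross := fun i hi => by
        simpa [Hecke.s, Hecke.y] using Hecke.mk_rel (.cross (i + 1) (Nat.succ_lt_succ hi))
      s_y_comm := fun i hi j h1 h2 => by
        simpa [Hecke.s, Hecke.y] using Hecke.mk_rel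
          (.s_y_comm (i + 1) (Nat.succ_lt_succ hi) j.succ (by simpa using h1)
            (by simpa using h2)) }

/-- `ℍ_m`-modules that are finite-dimensional over `ℂ`. -/
def IsFinDim (m : ℕ) : ObjectProperty (ModuleCat.{u} (Hecke m)) := fun M =>
  Module.Finite ℂ ((ModuleCat.restrictScalars (algebraMap ℂ (Hecke m))).obj M)

/-- The category of finite-dimensional `ℍ_m`-modules. -/
abbrev HeckeMod (m : ℕ) := (IsFinDim.{u} m).FullSubcategory

/-- Restriction of modules along the shifted embedding `ℍ_m → ℍ_{m+1}`. -/
def restrictShift (m : ℕ) : HeckeMod.{u} (m + 1) ⥤ HeckeMod.{u} m :=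
  (IsFinDim.{u} m).lift
    ((IsFinDim.{u} (m + 1)).ι ⋙ ModuleCat.restrictScalars (Hecke.shift m).toRingHom) (by
      rintro ⟨M, hM⟩
      have h : (Hecke.shift m).toRingHom.comp (algebraMap ℂ (Hecke m)) =
        algebraMap ℂ (Hecke (m + 1)) := (Hecke.shift m).comp_algebraMap
      unfold IsFinDim at hM ⊢
      rw [← h] at hM
      exact hM)

/-! ### Casimir tensors -/

section Casimir

variable {n : ℕ} {R : Type*} [Ring R] [Algebra ℂ R] {ι : Type*}

/-- The elementary matrix `E_{i,j}`. -/
def elem {n : ℕ} (i j : Fin n) : Matrix (Fin n) (Fin n) ℂ := Matrix.single i j 1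

/-- `∑_{i,j} f(E_{i,j}) g(E_{j,i})`. -/
def casimir (f g : Matrix (Fin n) (Fin n) ℂ →ₗ[ℂ] R) : R :=
  ∑ i, ∑ j, f (elem i j) * g (elem j i)

theorem elem_mul (i j : Fin n) (B : Matrix (Fin n) (Fin n) ℂ) :
    elem i j * B = ∑ q, B j q • elem i q := by
  ext a b
  simp [elem, Matrix.sum_apply, Matrix.single_apply, Matrix.mul_apply, Finset.sum_ite_eq,
    ite_and]

theorem mul_elem (i j : Fin n) (B : Matrix (Fin n) (Fin n) ℂ) :
    B * elem i j = ∑ p, B p i • elem p j := by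
  ext a b
  simp [elem, Matrix.sum_apply, Matrix.single_apply, Matrix.mul_apply, Finset.sum_ite_eq,
    ite_and]

theorem casimir_mul_right (f g : Matrix (Fin n) (Fin n) ℂ →ₗ[ℂ] R)
    (B : Matrix (Fin n) (Fin n) ℂ) :
    casimir (f ∘ₗ LinearMap.mulRight ℂ B) g = casimir f (g ∘ₗ LinearMap.mulLeft ℂ B) := by
  simp only [casimir, LinearMap.comp_apply, LinearMap.mulRight_apply, LinearMap.mulLeft_apply,
    elem_mul, mul_elem, map_sum, map_smul, Finset.sum_mul, Finset.mul_sum, smul_mul_assoc,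
    mul_smul_comm]
  refine Finset.sum_congr rfl fun i _ => ?_
  rw [Finset.sum_comm]

theorem casimir_mul_left (f g : Matrix (Fin n) (Fin n) ℂ →ₗ[ℂ] R)
    (B : Matrix (Fin n) (Fin n) ℂ) :
    casimir (f ∘ₗ LinearMap.mulLeft ℂ B) g = casimir f (g ∘ₗ LinearMap.mulRight ℂ B) := by
  simp only [casimir, LinearMap.comp_apply, LinearMap.mulRight_apply, LinearMap.mulLeft_apply,
    elem_mul, mul_elem, map_sum, map_smul, Finset.sum_mul, Finset.mul_sum, smul_mul_assoc,
    mul_smul_comm]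
  rw [Finset.sum_comm]
  conv_rhs => rw [Finset.sum_comm]
  refine Finset.sum_congr rfl fun j _ => ?_
  rw [Finset.sum_comm]

/-- Families of commuting linear maps `gl_n → R`, each of which respects brackets. -/
structure IsLieFamily (a : ι → Matrix (Fin n) (Fin n) ℂ →ₗ[ℂ] R) : Prop where
  comm : ∀ x y, x ≠ y → ∀ A B, a x A * a y B = a y B * a x A
  lie : ∀ x A B, a x (A * B - B * A) = a x A * a x B - a x B * a x A

/-- The linear map `a x` is multiplicative and unital. -/
structure IsMult (f : Matrix (Fin n) (Fin n) ℂ →ₗ[ℂ] R) : Prop where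
  mul : ∀ A B, f (A * B) = f A * f B
  one : f 1 = 1

variable {a : ι → Matrix (Fin n) (Fin n) ℂ →ₗ[ℂ] R}

theorem IsLieFamily.symm (h : IsLieFamily a) {x y : ι} (hxy : x ≠ y) :
    casimir (a x) (a y) = casimir (a y) (a x) := by
  unfold casimir
  rw [Finset.sum_comm]
  exact Finset.sum_congr rfl fun i _ => Finset.sum_congr rfl fun j _ => h.comm _ _ hxy _ _

theorem IsLieFamily.commute_far (h : IsLieFamily a) {x y z : ι} (hx : z ≠ x) (hy : z ≠ y)
    (A : Matrix (Fin n) (Fin n) ℂ) : Commute (casimir (a x) (a y)) (a z A) := by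
  refine Commute.sum_left _ _ _ fun i _ => Commute.sum_left _ _ _ fun j _ => ?_
  exact Commute.mul_left (h.comm _ _ hx.symm _ _) (h.comm _ _ hy.symm _ _)

theorem IsLieFamily.commute_sum (h : IsLieFamily a) {x y : ι} (hxy : x ≠ y)
    (A : Matrix (Fin n) (Fin n) ℂ) : Commute (casimir (a x) (a y)) (a x A + a y A) := by
  have h1 := casimir_mul_right (a x) (a y) A
  have h2 := casimir_mul_left (a x) (a y) A
  unfold casimir at *
  simp only [LinearMap.comp_apply, LinearMap.mulRight_apply, LinearMap.mulLeft_apply] at h1 h2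
  rw [Commute, SemiconjBy, ← sub_eq_zero]
  calc _ = ∑ i, ∑ j, (a x (elem i j * A - A * elem i j) * a y (elem j i)
        + a x (elem i j) * a y (elem j i * A - A * elem j i)) := by
        simp only [Finset.sum_mul, Finset.mul_sum]
        rw [← Finset.sum_sub_distrib]
        refine Finset.sum_congr rfl fun i _ => ?_
        rw [← Finset.sum_sub_distrib]
        refine Finset.sum_congr rfl fun j _ => ?_
        rw [h.lie, h.lie]
        have e1 : a y (elem j i) * a x A = a x A * a y (elem j i) := h.comm _ _ hxy.symm _ _
        have e2 : a y A * a x (elem i j) = a x (elem i j) * a y A := h.comm _ _ hxy.symm _ _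
        simp only [mul_add, add_mul, sub_mul, mul_sub]
        rw [mul_assoc (a x (elem i j)) (a y (elem j i)) (a x A), e1, ← mul_assoc (a y A), e2]
        simp only [mul_assoc]
        abel
    _ = 0 := by
        simp only [map_sub, sub_mul, mul_sub, Finset.sum_add_distrib, Finset.sum_sub_distrib]
        rw [h1, h2]
        abel

/-- The infinitesimal braid relation. -/
theorem IsLieFamily.braid (h : IsLieFamily a) {x y z : ι} (hxy : x ≠ y) (hxz : x ≠ z)
    (hyz : y ≠ z) :
    Commute (casimir (a x) (a y)) (casimir (a x) (a z) + casimir (a y) (a z)) := by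
  have : casimir (a x) (a z) + casimir (a y) (a z) =
      ∑ i, ∑ j, (a x (elem i j) + a y (elem i j)) * a z (elem j i) := by
    simp only [casimir, add_mul, Finset.sum_add_distrib]
  rw [this]
  refine Commute.sum_right _ _ _ fun i _ => Commute.sum_right _ _ _ fun j _ => ?_
  exact (h.commute_sum hxy _).mul_right (h.commute_far hxz.symm hyz.symm _)

theorem IsLieFamily.commute_disjoint (h : IsLieFamily a) {x y z w : ι} (hx : z ≠ x) (hy : z ≠ y)
    (hx2 : w ≠ x) (hy2 : w ≠ y) : Commute (casimir (a x) (a y)) (casimir (a z) (a w)) := by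
  refine Commute.sum_right _ _ _ fun i _ => Commute.sum_right _ _ _ fun j _ => ?_
  exact (h.commute_far hx hy _).mul_right (h.commute_far hx2 hy2 _)

theorem IsLieFamily.swap_left (h : IsLieFamily a) {x y : ι} (hxy : x ≠ y) (hx : IsMult (a x))
    (hy : IsMult (a y)) (A : Matrix (Fin n) (Fin n) ℂ) :
    casimir (a x) (a y) * a x A = a y A * casimir (a x) (a y) := by
  have h1 := casimir_mul_right (a x) (a y) A
  unfold casimir at *
  simp only [LinearMap.comp_apply, LinearMap.mulRight_apply, LinearMap.mulLeft_apply, hx.mul,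
    hy.mul] at h1
  simp only [Finset.sum_mul, Finset.mul_sum]
  refine Eq.trans (Finset.sum_congr rfl fun i _ => Finset.sum_congr rfl fun j _ => ?_)
    (h1.trans (Finset.sum_congr rfl fun i _ => Finset.sum_congr rfl fun j _ => ?_))
  · rw [mul_assoc, mul_assoc, h.comm _ _ hxy]
  · rw [← mul_assoc, ← mul_assoc, h.comm _ _ hxy]

theorem IsLieFamily.swap_right (h : IsLieFamily a) {x y : ι} (hxy : x ≠ y) (hx : IsMult (a x))
    (hy : IsMult (a y)) (A : Matrix (Fin n) (Fin n) ℂ) :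
    casimir (a x) (a y) * a y A = a x A * casimir (a x) (a y) := by
  rw [h.symm hxy]
  exact h.swap_left hxy.symm hy hx A

theorem IsLieFamily.casimir_sq (h : IsLieFamily a) {x y : ι} (hxy : x ≠ y) (hx : IsMult (a x))
    (hy : IsMult (a y)) : casimir (a x) (a y) * casimir (a x) (a y) = 1 := by
  have key : casimir (a x) (a y) * casimir (a x) (a y) =
      ∑ i, ∑ j, a x (elem j i) * casimir (a x) (a y) * a x (elem i j) := by
    conv_lhs => enter [2]; unfold casimir
    simp only [Finset.mul_sum]
    refine Finset.sum_congr rfl fun i _ => Finset.sum_congr rfl fun j _ => ?_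
    rw [h.comm _ _ hxy, ← mul_assoc, h.swap_right hxy hx hy]
  have e : ∀ i j k l : Fin n, (elem i j * elem k l : Matrix (Fin n) (Fin n) ℂ) =
      if j = k then elem i l else 0 := by
    intro i j k l
    split_ifs with hjk
    · subst hjk; simp [elem]
    · simp [elem, hjk]
  have s1 : ∀ i j : Fin n, a x (elem j i) * casimir (a x) (a y) * a x (elem i j) =
      a x (elem j j) * a y (elem i i) := by
    intro i j
    unfold casimir
    simp only [Finset.mul_sum, Finset.sum_mul]
    have : ∀ p q : Fin n, a x (elem j i) * (a x (elem p q) * a y (elem q p)) * a x (elem i j) =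
        if i = p then (if q = i then a x (elem j j) * a y (elem i i) else 0) else 0 := by
      intro p q
      rw [mul_assoc, mul_assoc, ← h.comm _ _ hxy, ← mul_assoc, ← mul_assoc, ← hx.mul, ← hx.mul,
        e, ite_mul, zero_mul, e]
      split_ifs <;> simp_all
    simp [this]
  rw [key]
  simp only [s1]
  have one_eq : (1 : Matrix (Fin n) (Fin n) ℂ) = ∑ i, elem i i := by
    ext p q
    simp [elem, Matrix.sum_apply, Matrix.single_apply, Matrix.one_apply, ite_and]
  simp only [← Finset.sum_mul, ← Finset.mul_sum, ← map_sum, ← one_eq, hx.one, hy.one, mul_one]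

theorem IsLieFamily.swap_casimir (h : IsLieFamily a) {x y z : ι} (hxy : x ≠ y) (hzx : z ≠ x)
    (hzy : z ≠ y) (hx : IsMult (a x)) (hy : IsMult (a y)) :
    casimir (a x) (a y) * casimir (a z) (a x) = casimir (a z) (a y) * casimir (a x) (a y) := by
  conv_lhs => enter [2]; unfold casimir
  conv_rhs => enter [1]; unfold casimir
  simp only [Finset.mul_sum, Finset.sum_mul]
  refine Finset.sum_congr rfl fun i _ => Finset.sum_congr rfl fun j _ => ?_
  rw [← mul_assoc, (h.commute_far hzx hzy _).eq, mul_assoc, h.swap_left hxy hx hy, mul_assoc]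

/-- The elements `s_k` and `y_l`, and the fact that they satisfy the Hecke relations, for a Lie
family indexed by `0, …, m` that is multiplicative at the indices `1, …, m`. -/
def casimirDatum {m : ℕ} {a : Fin (m + 1) → Matrix (Fin n) (Fin n) ℂ →ₗ[ℂ] R}
    (h : IsLieFamily a) (hm : ∀ k : Fin m, IsMult (a k.succ)) : HeckeDatum m R where
  y l := ∑ x ∈ Finset.Iio l.succ, casimir (a x) (a l.succ) + ((n : ℂ) / 2) • (1 : R)
  s k hk := -casimir (a (Fin.succ ⟨k, Nat.lt_of_succ_lt hk⟩)) (a (Fin.succ ⟨k + 1, hk⟩))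
  y_comm := by
    have main : ∀ i j : Fin m, i < j →
        Commute (∑ x ∈ Finset.Iio i.succ, casimir (a x) (a i.succ))
          (∑ x ∈ Finset.Iio j.succ, casimir (a x) (a j.succ)) := by
      intro i j hij
      refine Commute.sum_left _ _ _ fun x hx => ?_
      have hx : x < i.succ := by simpa using hx
      have hij' : i.succ < j.succ := by simpa using hij
      rw [← Finset.add_sum_erase _ _ (show x ∈ Finset.Iio j.succ by simpa using hx.trans hij'),
        ← Finset.add_sum_erase _ _ (show i.succ ∈ (Finset.Iio j.succ).erase x by
          simpa using ⟨hx.ne', hij⟩), ← add_assoc]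
      refine Commute.add_right (h.braid hx.ne (hx.trans hij').ne hij'.ne) ?_
      refine Commute.sum_right _ _ _ fun z hz => ?_
      simp only [Finset.mem_erase, Finset.mem_Iio] at hz
      exact h.commute_disjoint hz.2.1 hz.1 (hx.trans hij').ne' hij'.ne'
    intro i j
    have comm : Commute (∑ x ∈ Finset.Iio i.succ, casimir (a x) (a i.succ))
          (∑ x ∈ Finset.Iio j.succ, casimir (a x) (a j.succ)) := by
      rcases lt_trichotomy i j with hij | hij | hij
      · exact main i j hij
      · subst hij; exact Commute.refl _
      · exact (main j i hij).symm
    have c1 : ∀ r : R, Commute (((n : ℂ) / 2) • (1 : R)) r := fun r =>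
      (Commute.one_left r).smul_left _
    exact (comm.add_left (c1 _)).add_right (c1 _).symm
  s_sq i hi := by
    rw [neg_mul_neg]
    exact h.casimir_sq (by simp [Fin.ext_iff]) (hm _) (hm _)
  braid i hi hi2 := by
    simp only [neg_mul, mul_neg, neg_neg, neg_inj]
    set x : Fin (m + 1) := Fin.succ ⟨i, Nat.lt_of_succ_lt hi⟩ with hx
    set y : Fin (m + 1) := Fin.succ ⟨i + 1, hi⟩ with hy
    set z : Fin (m + 1) := Fin.succ ⟨i + 1 + 1, hi2⟩ with hz
    have hxy : x ≠ y := by simp [hx, hy, Fin.ext_iff]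
    have hyz : y ≠ z := by simp [hz, hy, Fin.ext_iff]
    have hxz : x ≠ z := by simp only [hx, hz, ne_eq, Fin.ext_iff, Fin.val_succ]; omega
    have mx : IsMult (a x) := hm _
    have my : IsMult (a y) := hm _
    have mz : IsMult (a z) := hm _
    have e1 : casimir (a x) (a y) * casimir (a y) (a z) =
        casimir (a x) (a z) * casimir (a x) (a y) := by
      have := h.swap_casimir hxy.symm hyz.symm hxz.symm my mx
      rwa [h.symm hxy.symm, h.symm hyz.symm, h.symm hxz.symm] at this
    have e2 : casimir (a y) (a z) * casimir (a x) (a y) =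
        casimir (a x) (a z) * casimir (a y) (a z) := h.swap_casimir hyz hxy hxz my mz
    rw [e1, mul_assoc, h.casimir_sq hxy mx my, e2, mul_assoc, h.casimir_sq hyz my mz]
  s_comm i j hi hj hij := by
    rw [neg_mul_neg, neg_mul_neg]
    refine h.commute_disjoint ?_ ?_ ?_ ?_ <;>
      simp only [ne_eq, Fin.ext_iff, Fin.val_succ] <;> omega
  cross i hi := by
    set x : Fin (m + 1) := Fin.succ ⟨i, Nat.lt_of_succ_lt hi⟩ with hx
    set y : Fin (m + 1) := Fin.succ ⟨i + 1, hi⟩ with hy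
    have hxy : x < y := by simp [hx, hy]
    have hI : Finset.Iio y = insert x (Finset.Iio x) := by
      ext z
      simp only [Finset.mem_Iio, Finset.mem_insert, hx, hy, Fin.lt_def, Fin.ext_iff,
        Fin.val_succ]
      omega
    have e : casimir (a x) (a y) * ∑ z ∈ Finset.Iio x, casimir (a z) (a x) =
        (∑ z ∈ Finset.Iio x, casimir (a z) (a y)) * casimir (a x) (a y) := by
      rw [Finset.mul_sum, Finset.sum_mul]
      refine Finset.sum_congr rfl fun z hz => ?_
      have hz : z < x := by simpa using hz
      exact h.swap_casimir hxy.ne hz.ne (hz.trans hxy).ne (hm _) (hm _)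
    rw [hI, Finset.sum_insert (by simp)]
    simp only [mul_add, add_mul, neg_mul, mul_neg, e, h.casimir_sq hxy.ne (hm _) (hm _),
      mul_smul_comm, smul_mul_assoc, mul_one, one_mul, smul_neg]
    abel
  s_y_comm i hi j h1 h2 := by
    set x : Fin (m + 1) := Fin.succ ⟨i, Nat.lt_of_succ_lt hi⟩ with hx
    set y : Fin (m + 1) := Fin.succ ⟨i + 1, hi⟩ with hy
    have hxy : x ≠ y := by simp [hx, hy, Fin.ext_iff]
    have hxj : x ≠ j.succ := by simp only [hx, ne_eq, Fin.ext_iff, Fin.val_succ]; omega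
    have hyj : y ≠ j.succ := by simp only [hy, ne_eq, Fin.ext_iff, Fin.val_succ]; omega
    refine Commute.neg_left (Commute.add_right ?_ ((Commute.one_right _).smul_right _))
    rcases lt_or_gt_of_ne h1 with hlt | hgt
    · refine Commute.sum_right _ _ _ fun z hz => ?_
      have hz : z < j.succ := by simpa using hz
      have hz' : (z : ℕ) < j + 1 := by simpa [Fin.lt_def] using hz
      refine h.commute_disjoint ?_ ?_ hxj.symm hyj.symm <;>
        simp only [hx, hy, ne_eq, Fin.ext_iff, Fin.val_succ] <;> omega
    · have hxm : x ∈ Finset.Iio j.succ := by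
        simp only [Finset.mem_Iio, hx, Fin.lt_def, Fin.val_succ]; omega
      have hym : y ∈ (Finset.Iio j.succ).erase x := by
        simp only [Finset.mem_erase, Finset.mem_Iio, hy, Fin.lt_def, Fin.val_succ]
        exact ⟨hxy.symm, by omega⟩
      rw [← Finset.add_sum_erase _ _ hxm, ← Finset.add_sum_erase _ _ hym, ← add_assoc]
      refine Commute.add_right (h.braid hxy hxj hyj) ?_
      refine Commute.sum_right _ _ _ fun z hz => ?_
      simp only [Finset.mem_erase] at hz
      exact h.commute_disjoint hz.2.1 hz.1 hxj.symm hyj.symm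

end Casimir

/-! ### The Lie algebra of `GL(n, ℂ)` and its complexification -/

/-- `𝔤₀ = 𝔤𝔩(n, ℂ)`. -/
abbrev Mat (n : ℕ) := Matrix (Fin n) (Fin n) ℂ

/-- `𝔤 = 𝔤₀ ⊗_ℝ ℂ`, where `𝔤₀` is regarded as a real Lie algebra. The complex structure `j` of `𝔤`
is multiplication on the first tensor factor. -/
abbrev gC (n : ℕ) := ℂ ⊗[ℝ] Mat n

/-- The maximal compact subgroup `K = U(n)`. -/
abbrev UK (n : ℕ) := Matrix.unitaryGroup (Fin n) ℂ

/-- Entrywise complex conjugation of a matrix. -/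
def conjM {n : ℕ} (E : Mat n) : Mat n := E.map (starRingEnd ℂ)

section conjM

variable {n : ℕ}

theorem conjM_add (A B : Mat n) : conjM (A + B) = conjM A + conjM B := by
  ext; simp [conjM]

theorem conjM_smul (c : ℂ) (A : Mat n) : conjM (c • A) = (starRingEnd ℂ c) • conjM A := by
  ext; simp [conjM]

theorem conjM_mul (A B : Mat n) : conjM (A * B) = conjM A * conjM B := by
  ext; simp [conjM, Matrix.mul_apply]

theorem conjM_sub (A B : Mat n) : conjM (A - B) = conjM A - conjM B := by
  ext; simp [conjM]

theorem conjM_one : conjM (1 : Mat n) = 1 := by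
  ext i j; simp [conjM, Matrix.one_apply, apply_ite]

theorem conjM_conjM (A : Mat n) : conjM (conjM A) = A := by
  ext; simp [conjM]

theorem conjM_real_smul (r : ℝ) (A : Mat n) : conjM (r • A) = r • conjM A := by
  ext; simp [conjM]

end conjM

theorem smul_eq_re_im {M : Type*} [AddCommGroup M] [Module ℂ M] [Module ℝ M] [IsScalarTower ℝ ℂ M]
    (c : ℂ) (x : M) : c • x = c.re • x + c.im • (Complex.I • x) := by
  have h : c = c.re • (1 : ℂ) + c.im • Complex.I := by
    apply Complex.ext <;> simp
  conv_lhs => rw [h, add_smul, smul_assoc, smul_assoc, one_smul]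

theorem gC_tmul_lie {n : ℕ} (c d : ℂ) (A B : Mat n) :
    ⁅(c ⊗ₜ[ℝ] A : gC n), (d ⊗ₜ[ℝ] B : gC n)⁆ = (c * d) ⊗ₜ[ℝ] (A * B - B * A) :=
  LieAlgebra.ExtendScalars.bracket_tmul ..

theorem gC_smul_lie {n : ℕ} (c : ℂ) (x y : gC n) : ⁅c • x, y⁆ = c • ⁅x, y⁆ := by
  rw [← lie_skew, lie_smul, ← lie_skew x y, smul_neg]

/-- `φ^L(E) = ½ (E - j i E)`, a homomorphism of complex Lie algebras `𝔤₀ → 𝔤`. -/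
def phiL {n : ℕ} : Mat n →ₗ⁅ℂ⁆ gC n where
  toFun E := (1 / 2 : ℂ) • ((1 : ℂ) ⊗ₜ[ℝ] E - Complex.I ⊗ₜ[ℝ] (Complex.I • E))
  map_add' A B := by
    simp only [smul_add, TensorProduct.tmul_add]
    module
  map_smul' c A := by
    simp only [RingHom.id_apply]
    rw [smul_comm c, smul_comm Complex.I c A, smul_eq_re_im c A,
      smul_eq_re_im c (Complex.I • A)]
    congr 1
    have e1 : c * 1 = c.re • (1 : ℂ) + c.im • Complex.I := by apply Complex.ext <;> simp
    have e2 : c * Complex.I = c.re • Complex.I - c.im • (1 : ℂ) := by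
      apply Complex.ext <;> simp
    simp only [← smul_assoc Complex.I, smul_eq_mul, Complex.I_mul_I, neg_smul, one_smul,
      TensorProduct.tmul_add, TensorProduct.tmul_smul, smul_sub,
      TensorProduct.smul_tmul', smul_neg, TensorProduct.tmul_neg, e1, e2,
      TensorProduct.add_tmul, TensorProduct.sub_tmul]
    abel
  map_lie' := by
    intro A B
    simp only [gC_smul_lie, lie_smul, sub_lie, lie_sub,
      gC_tmul_lie, LieRing.of_associative_ring_bracket,
      smul_mul_assoc, mul_smul_comm, smul_smul, Complex.I_mul_I, one_mul, mul_one, ← smul_sub]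
    simp only [neg_smul, one_smul, TensorProduct.neg_tmul, TensorProduct.tmul_neg, neg_neg]
    module

/-- `φ^R(E) = ½ (Ē + j i Ē)`, a homomorphism of complex Lie algebras `𝔤₀ → 𝔤`. -/
def phiR {n : ℕ} : Mat n →ₗ⁅ℂ⁆ gC n where
  toFun E := (1 / 2 : ℂ) • ((1 : ℂ) ⊗ₜ[ℝ] conjM E + Complex.I ⊗ₜ[ℝ] (Complex.I • conjM E))
  map_add' A B := by
    simp only [conjM_add, smul_add, TensorProduct.tmul_add]
    module
  map_smul' c A := by
    simp only [RingHom.id_apply, conjM_smul]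
    rw [smul_comm c, smul_comm Complex.I _ (conjM A), smul_eq_re_im _ (conjM A),
      smul_eq_re_im _ (Complex.I • conjM A)]
    congr 1
    have e1 : c * 1 = c.re • (1 : ℂ) + c.im • Complex.I := by apply Complex.ext <;> simp
    have e2 : c * Complex.I = c.re • Complex.I - c.im • (1 : ℂ) := by
      apply Complex.ext <;> simp
    simp only [← smul_assoc Complex.I, smul_eq_mul, Complex.I_mul_I, neg_smul, one_smul,
      TensorProduct.tmul_add, TensorProduct.tmul_smul, smul_add,
      TensorProduct.smul_tmul', smul_neg, TensorProduct.tmul_neg, e1, e2,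
      TensorProduct.add_tmul, TensorProduct.sub_tmul, Complex.conj_re, Complex.conj_im]
    abel
  map_lie' := by
    intro A B
    simp only [gC_smul_lie, lie_smul, add_lie, lie_add,
      gC_tmul_lie, LieRing.of_associative_ring_bracket, conjM_sub,
      conjM_mul, smul_mul_assoc, mul_smul_comm, smul_smul, Complex.I_mul_I, one_mul, mul_one,
      ← smul_sub]
    simp only [neg_smul, one_smul, TensorProduct.neg_tmul, TensorProduct.tmul_neg, neg_neg]
    module

theorem phiL_apply {n : ℕ} (E : Mat n) : phiL E =
    (1 / 2 : ℂ) • ((1 : ℂ) ⊗ₜ[ℝ] E - Complex.I ⊗ₜ[ℝ] (Complex.I • E)) := rfl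

theorem phiR_apply {n : ℕ} (E : Mat n) : phiR E =
    (1 / 2 : ℂ) • ((1 : ℂ) ⊗ₜ[ℝ] conjM E + Complex.I ⊗ₜ[ℝ] (Complex.I • conjM E)) := rfl

/-- The conjugate standard representation `V = ℂⁿ`, on which `g` acts by the matrix `ḡ`,
restricted to `K`. -/
def vK (n : ℕ) : Representation ℂ (UK n) (Fin n → ℂ) where
  toFun k := Matrix.toLin' (conjM (k : Mat n))
  map_one' := by simp [conjM_one, Module.End.one_eq_id]
  map_mul' k l := by simp [conjM_mul, Matrix.toLin'_mul, Module.End.mul_eq_comp]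

/-- Conjugation followed by the standard action, as a real-linear map. -/
def conjLin (n : ℕ) : Mat n →ₗ[ℝ] Module.End ℂ (Fin n → ℂ) where
  toFun E := Matrix.toLin' (conjM E)
  map_add' A B := by simp [conjM_add]
  map_smul' r A := by
    rw [conjM_real_smul, RingHom.id_apply]
    apply LinearMap.ext
    intro v
    ext i
    simp [Matrix.toLin'_apply, Matrix.smul_mulVec]

/-- The action of `𝔤` on the conjugate standard representation `V`: the complex-linear extension
of `E ↦ Ē`. -/
def vg (n : ℕ) : gC n →ₗ⁅ℂ⁆ Module.End ℂ (Fin n → ℂ) where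
  toLinearMap := TensorProduct.AlgebraTensorModule.lift
    (LinearMap.toSpanSingleton ℂ _ (conjLin n))
  map_lie' := by
    intro x y
    simp only [AddHom.toFun_eq_coe, LinearMap.coe_toAddHom]
    induction x using TensorProduct.induction_on with
    | zero => simp
    | add x x' hx hx' => rw [add_lie, map_add, hx, hx', map_add, add_lie]
    | tmul c A =>
      induction y using TensorProduct.induction_on with
      | zero => simp
      | add y y' hy hy' => rw [lie_add, map_add, hy, hy', map_add, lie_add]
      | tmul d B =>
        simp only [LieAlgebra.ExtendScalars.bracket_tmul,
          TensorProduct.AlgebraTensorModule.lift_tmul, LinearMap.toSpanSingleton_apply,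
          LinearMap.smul_apply, conjLin, LinearMap.coe_mk, AddHom.coe_mk,
          LieRing.of_associative_ring_bracket, conjM_sub, conjM_mul, map_sub,
          Matrix.toLin'_mul, Module.End.mul_eq_comp, LinearMap.smul_comp, LinearMap.comp_smul,
          smul_smul, smul_sub, mul_comm d c]

theorem vg_tmul (n : ℕ) (c : ℂ) (A : Mat n) :
    vg n (c ⊗ₜ[ℝ] A) = c • Matrix.toLin' (conjM A) := by
  change (TensorProduct.AlgebraTensorModule.lift
    (LinearMap.toSpanSingleton ℂ _ (conjLin n))) (c ⊗ₜ[ℝ] A) = _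
  simp [TensorProduct.AlgebraTensorModule.lift_tmul, conjLin]

/-- The element `(0, E)` of `𝔤` acts on `V` by the matrix `E`. -/
theorem vg_phiR (n : ℕ) (A : Mat n) : vg n (phiR A) = Matrix.toLin' A := by
  have hI : conjM (Complex.I • conjM A) = -(Complex.I • A) := by
    rw [conjM_smul, conjM_conjM]; simp
  simp only [phiR_apply, map_smul, map_add, vg_tmul, conjM_conjM, hI,
    map_neg, smul_neg, smul_smul, Complex.I_mul_I]
  module

/-- The element `(E, 0)` of `𝔤` acts on `V` by zero. -/
theorem vg_phiL (n : ℕ) (A : Mat n) : vg n (phiL A) = 0 := by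
  have hI : conjM (Complex.I • A) = -(Complex.I • conjM A) := by
    rw [conjM_smul]; simp
  simp only [phiL_apply, map_smul, map_sub, vg_tmul, hI,
    map_neg, smul_neg, smul_smul, Complex.I_mul_I]
  module

/-! ### `(𝔤, K)`-modules -/

/-- `exp(tZ)` for a skew-Hermitian matrix `Z`, as an element of `K`. -/
def expK {n : ℕ} (Z : Mat n) (hZ : Zᴴ = -Z) (t : ℝ) : UK n :=
  ⟨NormedSpace.exp (t • Z), by
    rw [Matrix.mem_unitaryGroup_iff', Matrix.star_eq_conjTranspose, ← Matrix.exp_conjTranspose,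
      Matrix.conjTranspose_smul, hZ, ← Matrix.exp_add_of_commute]
    · simp
    · simp only [star_trivial, smul_neg]
      exact (Commute.refl _).neg_left⟩

/-- `(𝔤, K)`-modules for `G = GL(n, ℂ)`: a complex vector space with a complex-linear action of `𝔤`
and a locally finite continuous action of `K` whose differential is the action of
`Lie(K) ⊆ 𝔤₀ ⊆ 𝔤`, compatible with the adjoint action of `K` on `𝔤`. -/
structure GKModule (n : ℕ) where
  carrier : Type u
  [addCommGroup : AddCommGroup carrier]
  [module : Module ℂ carrier]
  ρg : gC n →ₗ⁅ℂ⁆ Module.End ℂ carrier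
  ρK : Representation ℂ (UK n) carrier
  locally_finite : ∀ x : carrier, ∃ W : Submodule ℂ carrier, Module.Finite ℂ W ∧ x ∈ W ∧
    ∀ k, ∀ w ∈ W, ρK k w ∈ W
  continuous_coeff : ∀ (f : Module.Dual ℂ carrier) (x : carrier), Continuous fun k => f (ρK k x)
  deriv_coeff : ∀ (Z : Mat n) (hZ : Zᴴ = -Z) (f : Module.Dual ℂ carrier) (x : carrier),
    HasDerivAt (fun t : ℝ => f (ρK (expK Z hZ t) x)) (f (ρg ((1 : ℂ) ⊗ₜ[ℝ] Z) x)) 0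
  ad_compat : ∀ (k : UK n) (E : Mat n) (x : carrier),
    ρK k (ρg ((1 : ℂ) ⊗ₜ[ℝ] E) x) =
      ρg ((1 : ℂ) ⊗ₜ[ℝ] ((k : Mat n) * E * ((k⁻¹ : UK n) : Mat n))) (ρK k x)

instance (n : ℕ) : CoeSort (GKModule.{u} n) (Type u) := ⟨GKModule.carrier⟩

instance {n : ℕ} (X : GKModule.{u} n) : AddCommGroup X := X.addCommGroup

instance {n : ℕ} (X : GKModule.{u} n) : Module ℂ X := X.module

/-- Morphisms of `(𝔤, K)`-modules. -/
@[ext]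
structure GKHom {n : ℕ} (X Y : GKModule.{u} n) where
  toLin : X →ₗ[ℂ] Y
  comm_g : ∀ (A : gC n) (x : X), toLin (X.ρg A x) = Y.ρg A (toLin x)
  comm_K : ∀ (k : UK n) (x : X), toLin (X.ρK k x) = Y.ρK k (toLin x)

instance (n : ℕ) : Category (GKModule.{u} n) where
  Hom := GKHom
  id X := ⟨LinearMap.id, fun _ _ => rfl, fun _ _ => rfl⟩
  comp f g := ⟨g.toLin ∘ₗ f.toLin, fun A x => by simp [f.comm_g, g.comm_g],
    fun k x => by simp [f.comm_K, g.comm_K]⟩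

/-- A representation all of whose matrix coefficients are continuous. In finite dimension this is
continuity of the representation. -/
def HasContCoeff {n : ℕ} {W : Type*} [AddCommGroup W] [Module ℂ W]
    (σ : Representation ℂ (UK n) W) : Prop :=
  ∀ (f : Module.Dual ℂ W) (w : W), Continuous fun k => f (σ k w)

/-- Admissibility: every irreducible finite-dimensional continuous representation of `K` occurs
with finite multiplicity. -/
def IsAdmissible (n : ℕ) : ObjectProperty (GKModule.{u} n) := fun X =>
  ∀ (W : Type) [AddCommGroup W] [Module ℂ W] [Module.Finite ℂ W]
    (σ : Representation ℂ (UK n) W), HasContCoeff σ → σ.IsIrreducible →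
    Module.Finite ℂ (Representation.IntertwiningMap σ X.ρK)

/-- The category of Harish-Chandra modules, that is, admissible `(𝔤, K)`-modules. -/
abbrev HCMod (n : ℕ) := (IsAdmissible.{u} n).FullSubcategory

/-! ### Infinitesimal characters -/

/-- The universal enveloping algebra `U(𝔤)`. -/
abbrev Ug (n : ℕ) := UniversalEnvelopingAlgebra ℂ (gC n)

/-- The centre `Z(𝔤)` of `U(𝔤)`. -/
abbrev Zg (n : ℕ) := Subalgebra.center ℂ (Ug n)

/-- The action of `U(𝔤)` on a `(𝔤, K)`-module. -/
def GKModule.act {n : ℕ} (X : GKModule.{u} n) : Ug n →ₐ[ℂ] Module.End ℂ X :=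
  UniversalEnvelopingAlgebra.lift ℂ X.ρg

/-- The coordinates of `ρ`, half the sum of the positive roots of `𝔤𝔩(n)`. -/
def rhoC (n : ℕ) (i : Fin n) : ℂ := ((n : ℂ) - 1) / 2 - (i : ℂ)

/-- The left ideal of `U(𝔤)` that annihilates the highest weight vector of the Verma module of
highest weight `λ - ρ`, where `λ = (λ_L, λ_R)` in the coordinates `𝔥 ≅ 𝔥₀ × 𝔥₀` given by `φ^L` and
`φ^R`, and positive roots are those of the upper triangular matrices in both factors. -/
def vermaIdeal {n : ℕ} (lamL lamR : Fin n → ℂ) : Ideal (Ug n) :=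
  Ideal.span
    ({u | ∃ i j : Fin n, i < j ∧ (u = UniversalEnvelopingAlgebra.ι ℂ (phiL (elem i j)) ∨
        u = UniversalEnvelopingAlgebra.ι ℂ (phiR (elem i j)))} ∪
      {u | ∃ i : Fin n,
        u = UniversalEnvelopingAlgebra.ι ℂ (phiL (elem i i)) -
          algebraMap ℂ (Ug n) (lamL i - rhoC n i) ∨
        u = UniversalEnvelopingAlgebra.ι ℂ (phiR (elem i i)) -
          algebraMap ℂ (Ug n) (lamR i - rhoC n i)})

/-- `χ` is the character `χ_λ` of `Z(𝔤)` attached to `λ = (λ_L, λ_R)` by the Harish-Chandra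
isomorphism: `z ∈ Z(𝔤)` acts on the Verma module of highest weight `λ - ρ` by `χ(z)`. -/
def IsInfChar {n : ℕ} (lamL lamR : Fin n → ℂ) (χ : Zg n →ₐ[ℂ] ℂ) : Prop :=
  ∀ z : Zg n, (z : Ug n) - algebraMap ℂ (Ug n) (χ z) ∈ vermaIdeal lamL lamR

/-- `X` is `Z(𝔤)`-finite: `Z(𝔤)` acts through a finite-dimensional quotient. -/
def IsZFinite {n : ℕ} (X : GKModule.{u} n) : Prop :=
  Module.Finite ℂ (X.act.comp (Zg n).val).range

/-- `X` has generalized infinitesimal character determined by `λ = (λ_L, λ_R)`. -/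
def HasGenInfChar {n : ℕ} (lamL lamR : Fin n → ℂ) (X : GKModule.{u} n) : Prop :=
  ∃ χ : Zg n →ₐ[ℂ] ℂ, IsInfChar lamL lamR χ ∧
    ∀ (z : Zg n) (x : X), ∃ N : ℕ, ((X.act (z : Ug n) - algebraMap ℂ _ (χ z)) ^ N) x = 0

/-- The property of being a `Z(𝔤)`-finite Harish-Chandra module of generalized infinitesimal
character `λ = (λ_L, λ_R)`. -/
def IsHClam {n : ℕ} (lamL lamR : Fin n → ℂ) : ObjectProperty (GKModule.{u} n) := fun X =>
  IsAdmissible n X ∧ IsZFinite X ∧ HasGenInfChar lamL lamR X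

/-- The category `ℋ𝒞_λ`, `λ = (λ_L, λ_R)`. -/
abbrev HClam {n : ℕ} (lamL lamR : Fin n → ℂ) := (IsHClam.{u} lamL lamR).FullSubcategory

/-- The inclusion of `ℋ𝒞_λ` into the category of all Harish-Chandra modules. -/
def HClam.incl {n : ℕ} (lamL lamR : Fin n → ℂ) : HClam.{u} lamL lamR ⥤ HCMod.{u} n :=
  ObjectProperty.ιOfLE fun _ h => h.1

/-! ### Finite multiplicities -/

section Multiplicities

variable {n : ℕ}

theorem tmul_expand {X F : Type*} [AddCommGroup X] [Module ℂ X] [AddCommGroup F] [Module ℂ F]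
    {ι : Type*} [Fintype ι] (b : Module.Basis ι ℂ F) (f : Module.Dual ℂ (X ⊗[ℂ] F)) (x : X)
    (v : F) : f (x ⊗ₜ v) = ∑ i, b.repr v i * f (x ⊗ₜ b i) := by
  conv_lhs => rw [← b.sum_repr v, TensorProduct.tmul_sum, map_sum]
  simp [TensorProduct.tmul_smul]

theorem HasContCoeff.tprod {X F : Type*} [AddCommGroup X] [Module ℂ X] [AddCommGroup F]
    [Module ℂ F] [Module.Finite ℂ F] {ρ : Representation ℂ (UK n) X}
    {σ : Representation ℂ (UK n) F} (hρ : HasContCoeff ρ) (hσ : HasContCoeff σ) :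
    HasContCoeff (ρ.tprod σ) := by
  intro f w
  induction w using TensorProduct.induction_on with
  | zero => simpa using continuous_const
  | add w w' hw hw' =>
    simp only [map_add]
    exact hw.add hw'
  | tmul x v =>
    have b := Module.finBasis ℂ F
    simp only [Representation.tprod_apply, TensorProduct.map_tmul]
    have e : ∀ k, f (ρ k x ⊗ₜ σ k v) = ∑ i, b.repr (σ k v) i * f (ρ k x ⊗ₜ b i) :=
      fun k => tmul_expand b f _ _
    simp only [e]
    refine continuous_finsetSum _ fun i _ => Continuous.mul ?_ ?_
    · exact hσ (b.coord i) v
    · exact hρ (f ∘ₗ (TensorProduct.mk ℂ X F).flip (b i)) x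

theorem HasContCoeff.dual {F : Type*} [AddCommGroup F]
    [Module ℂ F] [Module.Finite ℂ F] {σ : Representation ℂ (UK n) F} (hσ : HasContCoeff σ) :
    HasContCoeff σ.dual := by
  intro f φ
  obtain ⟨v, rfl⟩ := (Module.evalEquiv ℂ F).surjective f
  have : ∀ k, (Module.evalEquiv ℂ F v) (σ.dual k φ) = φ (σ k⁻¹ v) := by
    intro k
    simp [Representation.dual_apply, Module.Dual.transpose_apply]
  simp only [this]
  exact (hσ φ v).comp continuous_inv

theorem finite_of_ker {A B : Type*} [AddCommGroup A] [Module ℂ A] [AddCommGroup B] [Module ℂ B]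
    [Module.Finite ℂ B] (f : A →ₗ[ℂ] B) (h : Module.Finite ℂ (LinearMap.ker f)) :
    Module.Finite ℂ A := by
  refine ⟨Submodule.fg_of_fg_map_of_fg_inf_ker f (IsNoetherian.noetherian _) ?_⟩
  rw [top_inf_eq]
  exact Module.Finite.iff_fg.mp h

/-- Finite multiplicity of irreducible representations implies finiteness of `Hom_K(W, X)` for all
finite-dimensional continuous `W`. -/
theorem IsAdmissible.finite_hom {X : GKModule.{u} n} (hX : IsAdmissible n X) (d : ℕ) :
    ∀ (W : Type) [AddCommGroup W] [Module ℂ W] [Module.Finite ℂ W]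
    (σ : Representation ℂ (UK n) W), HasContCoeff σ → Module.finrank ℂ W = d →
    Module.Finite ℂ (Representation.IntertwiningMap σ X.ρK) := by
  induction d using Nat.strong_induction_on with
  | _ d ih =>
  intro W _ _ _ σ hσ hd
  by_cases hirr : σ.IsIrreducible
  · exact hX W σ hσ hirr
  rcases subsingleton_or_nontrivial W with hW | hW
  · have : Subsingleton (Representation.IntertwiningMap σ X.ρK) := ⟨fun f g => by
      ext w
      rw [Subsingleton.elim w 0, map_zero, map_zero]⟩
    infer_instance
  obtain ⟨U, hU0, hU1⟩ : ∃ U : Subrepresentation σ, U.toSubmodule ≠ ⊥ ∧ U.toSubmodule ≠ ⊤ := by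
    by_contra hcon
    push Not at hcon
    refine hirr { exists_pair_ne := ⟨⊥, ⊤, fun h => ?_⟩, eq_bot_or_eq_top := fun U => ?_ }
    · have : (⊥ : Submodule ℂ W) = ⊤ := congrArg Subrepresentation.toSubmodule h
      exact bot_ne_top this
    · by_cases h : U.toSubmodule = ⊥
      · exact Or.inl (Subrepresentation.toSubmodule_injective h)
      · exact Or.inr (Subrepresentation.toSubmodule_injective (hcon U h))
  have hstab : ∀ k, U.toSubmodule ≤ U.toSubmodule.comap (σ k) := fun k w hw =>
    U.apply_mem_toSubmodule k hw
  have c1 : HasContCoeff U.toRepresentation := by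
    intro f w
    obtain ⟨g, hg⟩ := LinearMap.exists_extend f
    have : ∀ k, f (U.toRepresentation k w) = g (σ k w) := by
      intro k
      rw [← hg]
      rfl
    simp only [this]
    exact hσ g w
  have c2 : HasContCoeff (σ.quotient U.toSubmodule hstab) := by
    intro f w
    obtain ⟨w, rfl⟩ := U.toSubmodule.mkQ_surjective w
    exact hσ (f ∘ₗ U.toSubmodule.mkQ) w
  have f1 : Module.Finite ℂ (Representation.IntertwiningMap U.toRepresentation X.ρK) :=
    ih _ (hd ▸ Submodule.finrank_lt hU1) U.toSubmodule _ c1 rfl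
  have f2 : Module.Finite ℂ
      (Representation.IntertwiningMap (σ.quotient U.toSubmodule hstab) X.ρK) := by
    refine ih _ ?_ _ _ c2 rfl
    have h1 := Submodule.finrank_quotient_add_finrank U.toSubmodule
    have h2 : 0 < Module.finrank ℂ U.toSubmodule := by
      rw [Module.finrank_pos_iff]
      exact (Submodule.nontrivial_iff_ne_bot).mpr hU0
    omega
  let res : Representation.IntertwiningMap σ X.ρK →ₗ[ℂ]
      Representation.IntertwiningMap U.toRepresentation X.ρK :=
    { toFun := fun T => ⟨T.toLinearMap ∘ₗ U.toSubmodule.subtype, fun k => by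
        ext w
        exact LinearMap.congr_fun (T.isIntertwining' k) (w : W)⟩
      map_add' := fun _ _ => rfl
      map_smul' := fun _ _ => rfl }
  refine finite_of_ker res ?_
  have hker : ∀ T : LinearMap.ker res, U.toSubmodule ≤ LinearMap.ker T.1.toLinearMap := by
    intro T w hw
    have := congrArg (fun S => S.toLinearMap ⟨w, hw⟩) (LinearMap.mem_ker.mp T.2)
    exact this
  let q : LinearMap.ker res →ₗ[ℂ]
      Representation.IntertwiningMap (σ.quotient U.toSubmodule hstab) X.ρK :=
    { toFun := fun T => ⟨U.toSubmodule.liftQ T.1.toLinearMap (hker T), fun k => by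
        refine Submodule.linearMap_qext _ ?_
        ext w
        exact LinearMap.congr_fun (T.1.isIntertwining' k) w⟩
      map_add' := fun S T => by
        apply Representation.IntertwiningMap.ext
        refine Submodule.linearMap_qext _ ?_
        ext w
        rfl
      map_smul' := fun c T => by
        apply Representation.IntertwiningMap.ext
        refine Submodule.linearMap_qext _ ?_
        ext w
        rfl }
  refine Module.Finite.of_injective q fun S T h => ?_
  apply Subtype.ext
  apply Representation.IntertwiningMap.ext
  ext w
  exact congrArg (fun R => R.toLinearMap (U.toSubmodule.mkQ w)) h

theorem IsAdmissible.finite_hom_tensor {X : GKModule.{u} n} (hX : IsAdmissible n X)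
    (W F : Type) [AddCommGroup W] [Module ℂ W] [Module.Finite ℂ W] [AddCommGroup F] [Module ℂ F]
    [Module.Finite ℂ F] (τ : Representation ℂ (UK n) W) (σ : Representation ℂ (UK n) F)
    (hτ : HasContCoeff τ) (hσ : HasContCoeff σ) :
    Module.Finite ℂ (Representation.IntertwiningMap τ (X.ρK.tprod σ)) := by
  have hfin := hX.finite_hom _ (W ⊗[ℂ] Module.Dual ℂ F) (τ.tprod σ.dual) (hτ.tprod hσ.dual) rfl
  let c : Module.Dual ℂ F →ₗ[ℂ] X ⊗[ℂ] F →ₗ[ℂ] X :=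
    { toFun := fun φ => (TensorProduct.rid ℂ X).toLinearMap ∘ₗ φ.lTensor X
      map_add' := fun φ ψ => by rw [LinearMap.lTensor_add, LinearMap.comp_add]
      map_smul' := fun a φ => by
        rw [LinearMap.lTensor_smul, LinearMap.comp_smul, RingHom.id_apply] }
  have hc : ∀ φ x v, c φ (x ⊗ₜ v) = φ v • x := fun φ x v => by simp [c]
  have hequiv : ∀ k φ t, c (σ.dual k φ) (X.ρK.tprod σ k t) = X.ρK k (c φ t) := by
    intro k φ t
    induction t using TensorProduct.induction_on with
    | zero => simp
    | add t t' h h' => rw [map_add, map_add, h, h', map_add, map_add]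
    | tmul x v =>
      rw [Representation.tprod_apply, TensorProduct.map_tmul, hc, hc, map_smul]
      congr 1
      rw [Representation.dual_apply, Module.Dual.transpose_apply, LinearMap.comp_apply,
        ← Module.End.mul_apply, ← map_mul]
      simp
  let E : Representation.IntertwiningMap τ (X.ρK.tprod σ) →ₗ[ℂ]
      Representation.IntertwiningMap (τ.tprod σ.dual) X.ρK :=
    { toFun := fun T => ⟨TensorProduct.lift (c.flip ∘ₗ T.toLinearMap), fun k => by
        apply TensorProduct.ext'
        intro w φ
        have h := LinearMap.congr_fun (T.isIntertwining' k) w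
        simp only [LinearMap.comp_apply, Representation.tprod_apply, TensorProduct.map_tmul,
          TensorProduct.lift.tmul, LinearMap.flip_apply] at h ⊢
        rw [h]
        exact hequiv k φ _⟩
      map_add' := fun S T => by
        apply Representation.IntertwiningMap.ext
        apply TensorProduct.ext'
        intro w φ
        simp
      map_smul' := fun a T => by
        apply Representation.IntertwiningMap.ext
        apply TensorProduct.ext'
        intro w φ
        simp }
  refine Module.Finite.of_injective E fun S T h => ?_
  apply Representation.IntertwiningMap.ext
  ext w
  have b := Module.finBasis ℂ F
  have hexp : ∀ t : X ⊗[ℂ] F, t = ∑ i, c (b.coord i) t ⊗ₜ b i := by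
    intro t
    induction t using TensorProduct.induction_on with
    | zero => simp
    | add t t' h h' =>
      conv_lhs => rw [h, h']
      simp [TensorProduct.add_tmul, Finset.sum_add_distrib]
    | tmul x v =>
      simp only [hc, ← TensorProduct.tmul_smul, TensorProduct.smul_tmul, Module.Basis.coord_apply]
      rw [← TensorProduct.tmul_sum, b.sum_repr]
  have hST : ∀ φ, c φ (S.toLinearMap w) = c φ (T.toLinearMap w) := by
    intro φ
    have := congrArg (fun R => R.toLinearMap (w ⊗ₜ φ)) h
    simpa [E] using this
  rw [hexp (S.toLinearMap w), hexp (T.toLinearMap w)]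
  simp only [hST]

theorem IsAdmissible.finite_invariants {X : GKModule.{u} n} (hX : IsAdmissible n X)
    (F : Type) [AddCommGroup F] [Module ℂ F] [Module.Finite ℂ F]
    (σ : Representation ℂ (UK n) F) (hσ : HasContCoeff σ) :
    Module.Finite ℂ (X.ρK.tprod σ).invariants := by
  have h1 : HasContCoeff (1 : Representation ℂ (UK n) ℂ) := fun f w => by
    simpa using continuous_const
  have := hX.finite_hom_tensor ℂ F 1 σ h1 hσ
  let E : (X.ρK.tprod σ).invariants →ₗ[ℂ]
      Representation.IntertwiningMap (1 : Representation ℂ (UK n) ℂ) (X.ρK.tprod σ) :=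
    { toFun := fun t => ⟨LinearMap.toSpanSingleton ℂ _ t.1, fun k => by
        ext
        have := t.2 k
        simpa using this.symm⟩
      map_add' := fun s t => by
        apply Representation.IntertwiningMap.ext
        ext
        simp
      map_smul' := fun a t => by
        apply Representation.IntertwiningMap.ext
        ext
        simp }
  refine Module.Finite.of_injective E fun s t h => ?_
  apply Subtype.ext
  have := congrArg (fun R => R.toLinearMap (1 : ℂ)) h
  simpa [E] using this

end Multiplicities

/-! ### The functor `- ⊗ V` -/

section TensorV

variable {n : ℕ}

theorem continuous_conjM_coe : Continuous fun k : UK n => conjM (k : Mat n) :=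
  continuous_subtype_val.matrix_map Complex.continuous_conj

theorem vK_contCoeff (n : ℕ) : HasContCoeff (vK n) := by
  intro f w
  refine f.continuous_of_finiteDimensional.comp ?_
  change Continuous fun k : UK n => Matrix.toLin' (conjM (k : Mat n)) w
  simp only [Matrix.toLin'_apply]
  exact continuous_conjM_coe.matrix_mulVec continuous_const

theorem expK_zero (Z : Mat n) (hZ : Zᴴ = -Z) : expK Z hZ 0 = 1 := by
  apply Subtype.ext
  simp [expK]

theorem hasDerivAt_expK (Z : Mat n) (hZ : Zᴴ = -Z) (i j : Fin n) :
    HasDerivAt (fun t : ℝ => (expK Z hZ t : Mat n) i j) (Z i j) 0 := by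
  letI : NormedRing (Mat n) := Matrix.linftyOpNormedRing
  letI : NormedAlgebra ℝ (Mat n) := Matrix.linftyOpNormedAlgebra
  have h : HasDerivAt (fun t : ℝ => NormedSpace.exp (t • Z)) Z 0 := by
    have := hasDerivAt_exp_smul_const (𝕂 := ℝ) Z (0 : ℝ)
    simp only [zero_smul, NormedSpace.exp_zero, one_mul] at this
    exact this
  have h2 := (LinearMap.toContinuousLinearMap (Matrix.entryLinearMap ℝ ℂ i j)).hasFDerivAt.comp_hasDerivAt
    (0 : ℝ) h
  exact h2

theorem vK_deriv (Z : Mat n) (hZ : Zᴴ = -Z) (i : Fin n) (v : Fin n → ℂ) :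
    HasDerivAt (fun t : ℝ => vK n (expK Z hZ t) v i) (vg n ((1 : ℂ) ⊗ₜ[ℝ] Z) v i) 0 := by
  have e1 : ∀ t : ℝ, vK n (expK Z hZ t) v i =
      ∑ j, (starRingEnd ℂ) ((expK Z hZ t : Mat n) i j) * v j := by
    intro t
    change Matrix.toLin' (conjM (expK Z hZ t : Mat n)) v i = _
    simp [Matrix.toLin'_apply, Matrix.mulVec, dotProduct, conjM]
  have e2 : vg n ((1 : ℂ) ⊗ₜ[ℝ] Z) v i = ∑ j, (starRingEnd ℂ) (Z i j) * v j := by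
    rw [vg_tmul]
    simp [Matrix.toLin'_apply, Matrix.mulVec, dotProduct, conjM]
  simp only [e1, e2]
  refine HasDerivAt.fun_sum fun j _ => ?_
  refine HasDerivAt.mul_const ?_ _
  exact (hasDerivAt_expK Z hZ i j).star

/-- The action of `𝔤` on `X ⊗ V` by the Leibniz rule. -/
def GKModule.tensorg (X : GKModule.{u} n) : gC n →ₗ⁅ℂ⁆ Module.End ℂ (X ⊗[ℂ] (Fin n → ℂ)) where
  toFun := fun A => (X.ρg A).rTensor (Fin n → ℂ) + (vg n A).lTensor X
  map_add' := fun A B => by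
    simp only [map_add, LinearMap.rTensor_add, LinearMap.lTensor_add]
    abel
  map_smul' := fun c A => by
    simp only [map_smul, LinearMap.rTensor_smul, LinearMap.lTensor_smul, smul_add,
      RingHom.id_apply]
  map_lie' := fun {A B} => by
    simp only [LieHom.map_lie, LieRing.of_associative_ring_bracket, LinearMap.rTensor_sub,
      LinearMap.lTensor_sub]
    apply TensorProduct.ext'
    intro x v
    simp only [LinearMap.add_apply, LinearMap.sub_apply, LinearMap.rTensor_tmul,
      LinearMap.lTensor_tmul, Module.End.mul_apply, map_add]
    abel

theorem GKModule.tensorg_tmul (X : GKModule.{u} n) (A : gC n) (x : X) (v : Fin n → ℂ) :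
    X.tensorg A (x ⊗ₜ v) = X.ρg A x ⊗ₜ v + x ⊗ₜ vg n A v := rfl

/-- The `(𝔤, K)`-module `X ⊗ V`. -/
def GKModule.tensorV (X : GKModule.{u} n) : GKModule.{u} n where
  carrier := X ⊗[ℂ] (Fin n → ℂ)
  ρg := X.tensorg
  ρK := X.ρK.tprod (vK n)
  locally_finite := by
    intro t
    induction t using TensorProduct.induction_on with
    | zero => exact ⟨⊥, inferInstance, Submodule.zero_mem _, fun k w hw => by
        rw [Submodule.mem_bot] at hw; simp [hw]⟩
    | add s t hs ht =>
      obtain ⟨W, hW, hsW, hk⟩ := hs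
      obtain ⟨W', hW', htW, hk'⟩ := ht
      refine ⟨W ⊔ W', inferInstance, Submodule.add_mem_sup hsW htW, fun k w hw => ?_⟩
      obtain ⟨a, ha, b, hb, rfl⟩ := Submodule.mem_sup.mp hw
      rw [map_add]
      exact Submodule.add_mem_sup (hk k a ha) (hk' k b hb)
    | tmul x v =>
      obtain ⟨W, hW, hxW, hk⟩ := X.locally_finite x
      refine ⟨LinearMap.range (W.subtype.rTensor (Fin n → ℂ)), inferInstance,
        ⟨⟨x, hxW⟩ ⊗ₜ v, by simp⟩, ?_⟩
      rintro k w ⟨t, rfl⟩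
      induction t using TensorProduct.induction_on with
      | zero => simp
      | add s t hs ht =>
        rw [map_add, map_add]
        exact Submodule.add_mem _ hs ht
      | tmul y v' => exact ⟨⟨X.ρK k y, hk k y y.2⟩ ⊗ₜ vK n k v', by simp⟩
  continuous_coeff := HasContCoeff.tprod X.continuous_coeff (vK_contCoeff n)
  deriv_coeff := by
    intro Z hZ f w
    induction w using TensorProduct.induction_on with
    | zero => simpa using hasDerivAt_const (0 : ℝ) (0 : ℂ)
    | add s t hs ht =>
      simp only [map_add]
      exact hs.add ht
    | tmul x v =>
      have e1 : ∀ t : ℝ, f ((X.ρK.tprod (vK n)) (expK Z hZ t) (x ⊗ₜ v)) =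
          ∑ i, vK n (expK Z hZ t) v i *
            f (X.ρK (expK Z hZ t) x ⊗ₜ (Pi.basisFun ℂ (Fin n) i)) := by
        intro t
        rw [Representation.tprod_apply, TensorProduct.map_tmul,
          tmul_expand (Pi.basisFun ℂ (Fin n))]
        simp only [Pi.basisFun_repr]
      simp only [e1]
      have e2 : f (X.tensorg ((1 : ℂ) ⊗ₜ[ℝ] Z) (x ⊗ₜ v)) =
          ∑ i, (vg n ((1 : ℂ) ⊗ₜ[ℝ] Z) v i *
              f (X.ρK (expK Z hZ 0) x ⊗ₜ (Pi.basisFun ℂ (Fin n) i)) +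
            vK n (expK Z hZ 0) v i *
              f (X.ρg ((1 : ℂ) ⊗ₜ[ℝ] Z) x ⊗ₜ (Pi.basisFun ℂ (Fin n) i))) := by
        rw [expK_zero, map_one, map_one, GKModule.tensorg_tmul, map_add, tmul_expand (Pi.basisFun ℂ (Fin n)),
          tmul_expand (Pi.basisFun ℂ (Fin n)) f x, ← Finset.sum_add_distrib]
        refine Finset.sum_congr rfl fun i _ => ?_
        simp only [Pi.basisFun_repr, Module.End.one_apply]
        ring
      refine HasDerivAt.congr_deriv (HasDerivAt.fun_sum fun i _ => ?_) e2.symm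
      exact (vK_deriv Z hZ i v).mul
        (X.deriv_coeff Z hZ (f ∘ₗ (TensorProduct.mk ℂ X (Fin n → ℂ)).flip
          (Pi.basisFun ℂ (Fin n) i)) x)
  ad_compat := by
    intro k E w
    have hv : ∀ v, vK n k (vg n ((1 : ℂ) ⊗ₜ[ℝ] E) v) =
        vg n ((1 : ℂ) ⊗ₜ[ℝ] ((k : Mat n) * E * ((k⁻¹ : UK n) : Mat n))) (vK n k v) := by
      intro v
      have hk : conjM ((k⁻¹ : UK n) : Mat n) * conjM (k : Mat n) = 1 := by
        rw [← conjM_mul, ← Submonoid.coe_mul, inv_mul_cancel, Submonoid.coe_one, conjM_one]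
      have hvK : ∀ u, vK n k u = Matrix.toLin' (conjM (k : Mat n)) u := fun _ => rfl
      simp only [hvK, vg_tmul, one_smul, Matrix.toLin'_apply, Matrix.mulVec_mulVec, conjM_mul]
      rw [Matrix.mul_assoc (conjM (k : Mat n) * conjM E), hk, mul_one]
    induction w using TensorProduct.induction_on with
    | zero => simp
    | add s t hs ht => simp only [map_add, hs, ht]
    | tmul x v =>
      simp only [GKModule.tensorg_tmul, map_add,
        Representation.tprod_apply, TensorProduct.map_tmul, X.ad_compat, hv]

theorem IsAdmissible.tensorV {X : GKModule.{u} n} (hX : IsAdmissible n X) :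
    IsAdmissible n X.tensorV := by
  intro W _ _ _ σ hσ _
  exact hX.finite_hom_tensor W (Fin n → ℂ) σ (vK n) hσ (vK_contCoeff n)

/-- The functor `- ⊗ V` on `(𝔤, K)`-modules. -/
def tensorVGK (n : ℕ) : GKModule.{u} n ⥤ GKModule.{u} n where
  obj X := X.tensorV
  map {X Y} f :=
    { toLin := f.toLin.rTensor (Fin n → ℂ)
      comm_g := fun A t => by
        change (f.toLin.rTensor (Fin n → ℂ)) (X.tensorg A t) =
          Y.tensorg A ((f.toLin.rTensor (Fin n → ℂ)) t)
        induction t using TensorProduct.induction_on with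
        | zero => simp
        | add s t hs ht => simp only [map_add, hs, ht]
        | tmul x v => simp [f.comm_g, GKModule.tensorg_tmul]
      comm_K := fun k t => by
        change (f.toLin.rTensor (Fin n → ℂ)) ((X.ρK.tprod (vK n)) k t) =
          (Y.ρK.tprod (vK n)) k ((f.toLin.rTensor (Fin n → ℂ)) t)
        induction t using TensorProduct.induction_on with
        | zero => simp
        | add s t hs ht => simp only [map_add, hs, ht]
        | tmul x v => simp [f.comm_K] }
  map_id X := by
    apply GKHom.ext
    exact LinearMap.rTensor_id _ _
  map_comp f g := by
    apply GKHom.ext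
    exact LinearMap.rTensor_comp _ _ _

/-- The functor `- ⊗ V` on Harish-Chandra modules. -/
def tensorV (n : ℕ) : HCMod.{u} n ⥤ HCMod.{u} n :=
  (IsAdmissible.{u} n).lift ((IsAdmissible.{u} n).ι ⋙ tensorVGK n) fun X => X.property.tensorV

end TensorV

/-! ### The functor `Γ_{n,m}` -/

section Gamma

variable {n : ℕ}

/-- `V^{⊗m}`. -/
abbrev TV (n m : ℕ) := ⨂[ℂ]^m (Fin n → ℂ)

/-- The diagonal action of `K` on `V^{⊗m}`. -/
def vKpow (n m : ℕ) : Representation ℂ (UK n) (TV n m) where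
  toFun k := PiTensorProduct.map fun _ => vK n k
  map_one' := by
    simp only [map_one, Module.End.one_eq_id]
    exact PiTensorProduct.map_id
  map_mul' k l := by
    simp only [map_mul, Module.End.mul_eq_comp]
    exact PiTensorProduct.map_comp _ _

theorem vKpow_tprod (m : ℕ) (k : UK n) (v : Fin m → Fin n → ℂ) :
    vKpow n m k (PiTensorProduct.tprod ℂ v) = PiTensorProduct.tprod ℂ fun i => vK n k (v i) :=
  PiTensorProduct.map_tprod _ _

theorem vKpow_contCoeff (n m : ℕ) : HasContCoeff (vKpow n m) := by
  intro f w
  induction w using PiTensorProduct.induction_on with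
  | smul_tprod r v =>
    simp only [map_smul, vKpow_tprod]
    refine Continuous.const_smul ?_ r
    have e : ∀ k : UK n, f (PiTensorProduct.tprod ℂ fun i => vK n k (v i)) =
        ∑ p : Fin m → Fin n, (∏ i, vK n k (v i) (p i)) *
          f (PiTensorProduct.tprod ℂ fun i => Pi.basisFun ℂ (Fin n) (p i)) := by
      intro k
      have : (fun i => vK n k (v i)) =
          fun i => ∑ j, vK n k (v i) j • Pi.basisFun ℂ (Fin n) j := by
        funext i
        exact ((Pi.basisFun ℂ (Fin n)).sum_repr _).symm
      rw [this, MultilinearMap.map_sum, map_sum]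
      refine Finset.sum_congr rfl fun p _ => ?_
      rw [MultilinearMap.map_smul_univ, map_smul, smul_eq_mul]
    simp only [e]
    refine continuous_finsetSum _ fun p _ => Continuous.mul ?_ continuous_const
    exact continuous_finsetProd _ fun i _ => vK_contCoeff n (LinearMap.proj (p i)) (v i)
  | add x y hx hy =>
    simp only [map_add]
    exact hx.add hy

/-- An endomorphism of `V` acting on the `k`-th factor of `V^{⊗m}`. -/
def onFactor (n : ℕ) {m : ℕ} (k : Fin m) :
    Module.End ℂ (Fin n → ℂ) →ₗ[ℂ] Module.End ℂ (TV n m) :=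
  (PiTensorProduct.mapMultilinear ℂ (fun _ : Fin m => Fin n → ℂ)
    (fun _ : Fin m => Fin n → ℂ)).toLinearMap (fun _ => LinearMap.id) k

theorem onFactor_tprod {m : ℕ} (k : Fin m) (T : Module.End ℂ (Fin n → ℂ))
    (v : Fin m → Fin n → ℂ) : onFactor n k T (PiTensorProduct.tprod ℂ v) =
      PiTensorProduct.tprod ℂ (Function.update v k (T (v k))) := by
  change PiTensorProduct.map (Function.update (fun _ => LinearMap.id) k T)
    (PiTensorProduct.tprod ℂ v) = _
  rw [PiTensorProduct.map_tprod]
  congr 1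
  funext i
  by_cases h : i = k
  · subst h; simp
  · simp [h]

/-- `φ^R` as a linear map. -/
def phiRLin (n : ℕ) : Mat n →ₗ[ℂ] gC n where
  toFun := phiR
  map_add' A B := phiR.toLinearMap.map_add A B
  map_smul' c A := phiR.toLinearMap.map_smul c A

/-- The action of the element `(0, E)` of `𝔤` on the `x`-th factor of `X ⊗ V^{⊗m}`, where the
factors are numbered `0, …, m` and the zeroth one is `X`. -/
def slot (X : GKModule.{u} n) (m : ℕ) :
    Fin (m + 1) → Mat n →ₗ[ℂ] Module.End ℂ (X ⊗[ℂ] TV n m) :=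
  Fin.cases
    (LinearMap.rTensorHom (TV n m) ∘ₗ X.ρg.toLinearMap ∘ₗ phiRLin n)
    (fun k => LinearMap.lTensorHom X ∘ₗ onFactor n k ∘ₗ (vg n).toLinearMap ∘ₗ phiRLin n)

theorem slot_zero_tmul (X : GKModule.{u} n) (m : ℕ) (E : Mat n) (x : X) (t : TV n m) :
    slot X m 0 E (x ⊗ₜ t) = X.ρg (phiR E) x ⊗ₜ t := rfl

theorem slot_succ_tmul (X : GKModule.{u} n) (m : ℕ) (k : Fin m) (E : Mat n) (x : X)
    (t : TV n m) :
    slot X m k.succ E (x ⊗ₜ t) = x ⊗ₜ onFactor n k (vg n (phiR E)) t := rfl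

theorem tensor_ext {X Y : Type*} [AddCommGroup X] [Module ℂ X] [AddCommGroup Y] [Module ℂ Y]
    {m : ℕ} {f g : X ⊗[ℂ] TV n m →ₗ[ℂ] Y}
    (h : ∀ x v, f (x ⊗ₜ PiTensorProduct.tprod ℂ v) = g (x ⊗ₜ PiTensorProduct.tprod ℂ v)) :
    f = g := by
  apply TensorProduct.ext
  apply LinearMap.ext
  intro x
  apply PiTensorProduct.ext
  exact MultilinearMap.ext fun v => h x v

theorem slot_isLieFamily (X : GKModule.{u} n) (m : ℕ) : IsLieFamily (slot X m) where
  comm := by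
    have h0 : ∀ (k : Fin m) A B, slot X m 0 A * slot X m k.succ B =
        slot X m k.succ B * slot X m 0 A := by
      intro k A B
      apply TensorProduct.ext'
      intro x t
      simp only [Module.End.mul_apply, slot_zero_tmul, slot_succ_tmul]
    intro x y hxy A B
    induction x using Fin.cases with
    | zero =>
      induction y using Fin.cases with
      | zero => exact absurd rfl hxy
      | succ l => exact h0 l A B
    | succ k =>
      induction y using Fin.cases with
      | zero => exact (h0 k B A).symm
      | succ l =>
        have hkl : k ≠ l := fun h => hxy (by rw [h])
        apply tensor_ext
        intro x v
        simp only [Module.End.mul_apply, slot_succ_tmul, onFactor_tprod,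
          Function.update_of_ne hkl, Function.update_of_ne hkl.symm]
        rw [Function.update_comm hkl]
  lie := by
    intro x A B
    have hAB : phiR (A * B - B * A) = ⁅phiR A, phiR B⁆ := phiR.map_lie A B
    induction x using Fin.cases with
    | zero =>
      apply TensorProduct.ext'
      intro x t
      simp only [LinearMap.sub_apply, Module.End.mul_apply, slot_zero_tmul, hAB, LieHom.map_lie,
        LieRing.of_associative_ring_bracket, TensorProduct.sub_tmul]
    | succ k =>
      apply tensor_ext
      intro x v
      rw [slot_succ_tmul, hAB, LieHom.map_lie]
      simp only [LinearMap.sub_apply, Module.End.mul_apply, slot_succ_tmul,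
        LieRing.of_associative_ring_bracket, map_sub, onFactor_tprod, Function.update_self,
        Function.update_idem, TensorProduct.tmul_sub]

theorem slot_isMult (X : GKModule.{u} n) (m : ℕ) (k : Fin m) : IsMult (slot X m k.succ) where
  mul A B := by
    apply tensor_ext
    intro x v
    simp only [Module.End.mul_apply, slot_succ_tmul, vg_phiR, Matrix.toLin'_mul, onFactor_tprod,
      Function.update_self, Function.update_idem, LinearMap.comp_apply]
  one := by
    apply tensor_ext
    intro x v
    simp only [slot_succ_tmul, vg_phiR, Matrix.toLin'_one, onFactor_tprod, LinearMap.id_apply,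
      Function.update_eq_self, Module.End.one_apply]

/-- The operators `s_k` and `y_l` on `X ⊗ V^{⊗m}`:
`s_k = -∑_{i,j} (0, E_{i,j})_k (0, E_{j,i})_{k+1}` and
`y_l = ∑_{0 ≤ x < l} ∑_{i,j} (0, E_{i,j})_x (0, E_{j,i})_l + n/2`,
where the subscript is the number of the tensor factor on which the element of `𝔤` acts. -/
def gammaDatum (X : GKModule.{u} n) (m : ℕ) : HeckeDatum m (Module.End ℂ (X ⊗[ℂ] TV n m)) :=
  casimirDatum (slot_isLieFamily X m) (slot_isMult X m)

/-- The action of `ℍ_m` on `X ⊗ V^{⊗m}`. -/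
def gammaAct (X : GKModule.{u} n) (m : ℕ) : Hecke m →ₐ[ℂ] Module.End ℂ (X ⊗[ℂ] TV n m) :=
  (gammaDatum X m).lift

/-- The diagonal action of `K` on `X ⊗ V^{⊗m}`. -/
def gammaK (X : GKModule.{u} n) (m : ℕ) : Representation ℂ (UK n) (X ⊗[ℂ] TV n m) :=
  X.ρK.tprod (vKpow n m)

theorem gammaK_tmul (X : GKModule.{u} n) (m : ℕ) (k : UK n) (x : X) (t : TV n m) :
    gammaK X m k (x ⊗ₜ t) = X.ρK k x ⊗ₜ vKpow n m k t := rfl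

theorem conjM_mul_inv (k : UK n) : conjM (k : Mat n) * conjM ((k⁻¹ : UK n) : Mat n) = 1 := by
  rw [← conjM_mul, ← Submonoid.coe_mul, mul_inv_cancel, Submonoid.coe_one, conjM_one]

theorem conjM_inv_mul (k : UK n) : conjM ((k⁻¹ : UK n) : Mat n) * conjM (k : Mat n) = 1 := by
  rw [← conjM_mul, ← Submonoid.coe_mul, inv_mul_cancel, Submonoid.coe_one, conjM_one]

theorem ad_compat_phiR (X : GKModule.{u} n) (k : UK n) (E : Mat n) (x : X) :
    X.ρK k (X.ρg (phiR E) x) =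
      X.ρg (phiR (conjM (k : Mat n) * E * conjM ((k⁻¹ : UK n) : Mat n))) (X.ρK k x) := by
  have h : ∀ (c : ℂ) (A : Mat n), X.ρK k (X.ρg (c ⊗ₜ[ℝ] A) x) =
      X.ρg (c ⊗ₜ[ℝ] ((k : Mat n) * A * ((k⁻¹ : UK n) : Mat n))) (X.ρK k x) := by
    intro c A
    have e : ∀ B : Mat n, (c ⊗ₜ[ℝ] B : gC n) = c • ((1 : ℂ) ⊗ₜ[ℝ] B) := by
      intro B
      rw [TensorProduct.smul_tmul', smul_eq_mul, mul_one]
    rw [e A, e (_ * A * _), map_smul, map_smul, LinearMap.smul_apply, LinearMap.smul_apply,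
      map_smul, X.ad_compat]
  simp only [phiR_apply, map_smul, map_add, LinearMap.smul_apply, LinearMap.add_apply, h,
    conjM_mul, conjM_conjM, mul_smul_comm, smul_mul_assoc]

theorem gammaK_slot (X : GKModule.{u} n) (m : ℕ) (k : UK n) (x : Fin (m + 1)) (E : Mat n) :
    gammaK X m k * slot X m x E =
      slot X m x (conjM (k : Mat n) * E * conjM ((k⁻¹ : UK n) : Mat n)) * gammaK X m k := by
  induction x using Fin.cases with
  | zero =>
    apply TensorProduct.ext'
    intro x t
    simp only [Module.End.mul_apply, slot_zero_tmul, gammaK_tmul, ad_compat_phiR]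
  | succ l =>
    apply tensor_ext
    intro x v
    simp only [Module.End.mul_apply, slot_succ_tmul, gammaK_tmul, onFactor_tprod, vKpow_tprod]
    congr 2
    funext i
    by_cases h : i = l
    · subst h
      have hvK : ∀ u, vK n k u = Matrix.toLin' (conjM (k : Mat n)) u := fun _ => rfl
      simp only [Function.update_self, vg_phiR, hvK, Matrix.toLin'_apply, Matrix.mulVec_mulVec]
      rw [Matrix.mul_assoc (conjM (k : Mat n) * E), conjM_inv_mul, mul_one]
    · simp [h]

theorem gammaK_casimir (X : GKModule.{u} n) (m : ℕ) (k : UK n) (x y : Fin (m + 1)) :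
    Commute (gammaK X m k) (casimir (slot X m x) (slot X m y)) := by
  have h1 := casimir_mul_right (slot X m x ∘ₗ LinearMap.mulLeft ℂ (conjM (k : Mat n)))
    (slot X m y ∘ₗ LinearMap.mulLeft ℂ (conjM (k : Mat n)) ∘ₗ
      LinearMap.mulRight ℂ (conjM ((k⁻¹ : UK n) : Mat n))) (conjM ((k⁻¹ : UK n) : Mat n))
  have h2 := casimir_mul_left (slot X m x)
    (slot X m y ∘ₗ LinearMap.mulRight ℂ (conjM ((k⁻¹ : UK n) : Mat n))) (conjM (k : Mat n))
  simp only [casimir, LinearMap.comp_apply, LinearMap.mulRight_apply, LinearMap.mulLeft_apply,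
    mul_assoc, conjM_inv_mul, conjM_mul_inv, mul_one] at h1 h2
  simp only [← mul_assoc, conjM_inv_mul, conjM_mul_inv, one_mul] at h1 h2
  rw [Commute, SemiconjBy]
  have h3 := (h1.trans h2).symm
  unfold casimir
  conv_rhs => rw [h3]
  simp only [Finset.mul_sum, Finset.sum_mul]
  refine Finset.sum_congr rfl fun i _ => Finset.sum_congr rfl fun j _ => ?_
  rw [← mul_assoc, gammaK_slot, mul_assoc, gammaK_slot, ← mul_assoc]

theorem gammaAct_commute (X : GKModule.{u} n) (m : ℕ) (k : UK n) (h : Hecke m) :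
    Commute (gammaK X m k) (gammaAct X m h) := by
  refine HeckeDatum.lift_commute _ _ (fun l => ?_) (fun i hi => ?_) h
  · refine Commute.add_right (Commute.sum_right _ _ _ fun x _ => gammaK_casimir X m k _ _) ?_
    exact (Commute.one_right _).smul_right _
  · exact (gammaK_casimir X m k _ _).neg_right

/-- The space `(X ⊗ V^{⊗m})^K`. -/
def GammaSpace (X : GKModule.{u} n) (m : ℕ) : Submodule ℂ (X ⊗[ℂ] TV n m) :=
  (gammaK X m).invariants

theorem gammaAct_mem (X : GKModule.{u} n) (m : ℕ) (h : Hecke m) (t : X ⊗[ℂ] TV n m)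
    (ht : t ∈ GammaSpace X m) : gammaAct X m h t ∈ GammaSpace X m := by
  intro k
  have := LinearMap.congr_fun (gammaAct_commute X m k h).eq t
  rw [Module.End.mul_apply, Module.End.mul_apply, ht k] at this
  exact this

/-- The `ℍ_m`-module structure on `(X ⊗ V^{⊗m})^K`. -/
instance gammaModule (X : GKModule.{u} n) (m : ℕ) : Module (Hecke m) (GammaSpace X m) where
  smul h t := ⟨gammaAct X m h t.1, gammaAct_mem X m h t.1 t.2⟩
  one_smul t := Subtype.ext (by
    change gammaAct X m 1 t.1 = t.1
    rw [map_one, Module.End.one_apply])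
  mul_smul g h t := Subtype.ext (by
    change gammaAct X m (g * h) t.1 = gammaAct X m g (gammaAct X m h t.1)
    rw [map_mul, Module.End.mul_apply])
  smul_zero h := Subtype.ext (map_zero (gammaAct X m h))
  smul_add h s t := Subtype.ext (map_add (gammaAct X m h) s.1 t.1)
  add_smul g h t := Subtype.ext (by
    change gammaAct X m (g + h) t.1 = gammaAct X m g t.1 + gammaAct X m h t.1
    rw [map_add, LinearMap.add_apply])
  zero_smul t := Subtype.ext (by
    change gammaAct X m 0 t.1 = 0
    rw [map_zero, LinearMap.zero_apply])

theorem gamma_smul_coe (X : GKModule.{u} n) (m : ℕ) (h : Hecke m) (t : GammaSpace X m) :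
    ((h • t : GammaSpace X m) : X ⊗[ℂ] TV n m) = gammaAct X m h t := rfl

theorem slot_natural {X Y : GKModule.{u} n} (f : GKHom X Y) (m : ℕ) (x : Fin (m + 1))
    (E : Mat n) (t : X ⊗[ℂ] TV n m) :
    f.toLin.rTensor (TV n m) (slot X m x E t) = slot Y m x E (f.toLin.rTensor (TV n m) t) := by
  induction t using TensorProduct.induction_on with
  | zero => simp
  | add s t hs ht => simp only [map_add, hs, ht]
  | tmul y t =>
    induction x using Fin.cases with
    | zero => simp only [slot_zero_tmul, LinearMap.rTensor_tmul, f.comm_g]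
    | succ l => simp only [slot_succ_tmul, LinearMap.rTensor_tmul]

theorem casimir_natural {X Y : GKModule.{u} n} (f : GKHom X Y) (m : ℕ) (x y : Fin (m + 1))
    (t : X ⊗[ℂ] TV n m) :
    f.toLin.rTensor (TV n m) (casimir (slot X m x) (slot X m y) t) =
      casimir (slot Y m x) (slot Y m y) (f.toLin.rTensor (TV n m) t) := by
  simp only [casimir, LinearMap.sum_apply, map_sum, Module.End.mul_apply, slot_natural]

theorem gammaAct_natural {X Y : GKModule.{u} n} (f : GKHom X Y) (m : ℕ) (h : Hecke m)
    (t : X ⊗[ℂ] TV n m) :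
    f.toLin.rTensor (TV n m) (gammaAct X m h t) =
      gammaAct Y m h (f.toLin.rTensor (TV n m) t) := by
  obtain ⟨a, rfl⟩ := Hecke.mk_surjective m h
  simp only [gammaAct, HeckeDatum.lift_mk]
  induction a using FreeAlgebra.induction generalizing t with
  | grade0 c => simp [Algebra.algebraMap_eq_smul_one]
  | grade1 g =>
    rw [FreeAlgebra.lift_ι_apply, FreeAlgebra.lift_ι_apply]
    cases g with
    | y l =>
      change f.toLin.rTensor (TV n m) ((∑ x ∈ Finset.Iio l.succ,
        casimir (slot X m x) (slot X m l.succ) + ((n : ℂ) / 2) • 1 : Module.End ℂ _) t) =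
        (∑ x ∈ Finset.Iio l.succ,
          casimir (slot Y m x) (slot Y m l.succ) + ((n : ℂ) / 2) • 1 : Module.End ℂ _) _
      simp only [LinearMap.add_apply, LinearMap.sum_apply, map_add, map_sum, casimir_natural,
        LinearMap.smul_apply, map_smul, Module.End.one_apply]
    | s i hi =>
      change f.toLin.rTensor (TV n m) ((-casimir (slot X m _) (slot X m _) : Module.End ℂ _) t) =
        (-casimir (slot Y m _) (slot Y m _) : Module.End ℂ _) _
      simp only [LinearMap.neg_apply, map_neg, casimir_natural]
  | mul a b ha hb => simp only [map_mul, Module.End.mul_apply, ha, hb]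
  | add a b ha hb => simp only [map_add, LinearMap.add_apply, ha, hb]

theorem gammaK_natural {X Y : GKModule.{u} n} (f : GKHom X Y) (m : ℕ) (k : UK n)
    (t : X ⊗[ℂ] TV n m) :
    f.toLin.rTensor (TV n m) (gammaK X m k t) = gammaK Y m k (f.toLin.rTensor (TV n m) t) := by
  induction t using TensorProduct.induction_on with
  | zero => simp
  | add s t hs ht => simp only [map_add, hs, ht]
  | tmul y t => simp only [gammaK_tmul, LinearMap.rTensor_tmul, f.comm_K]

/-- `Γ_{n,m}` on morphisms: the restriction of `f ⊗ id` to `K`-fixed vectors. -/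
def gammaMap {X Y : GKModule.{u} n} (f : GKHom X Y) (m : ℕ) :
    GammaSpace X m →ₗ[Hecke m] GammaSpace Y m where
  toFun t := ⟨f.toLin.rTensor (TV n m) t.1, fun k => by
    rw [← gammaK_natural, t.2 k]⟩
  map_add' s t := Subtype.ext (map_add (f.toLin.rTensor (TV n m)) s.1 t.1)
  map_smul' h t := Subtype.ext (gammaAct_natural f m h t.1)

/-- `Γ_{n,m}` on all `(𝔤, K)`-modules. -/
def GammaGK (n m : ℕ) : GKModule.{u} n ⥤ ModuleCat.{u} (Hecke m) where
  obj X := ModuleCat.of (Hecke m) (GammaSpace X m)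
  map f := ModuleCat.ofHom (gammaMap f m)
  map_id X := by
    apply ModuleCat.hom_ext
    apply LinearMap.ext
    intro t
    apply Subtype.ext
    exact LinearMap.congr_fun (LinearMap.rTensor_id (TV n m) X) t.1
  map_comp f g := by
    apply ModuleCat.hom_ext
    apply LinearMap.ext
    intro t
    apply Subtype.ext
    exact LinearMap.congr_fun (LinearMap.rTensor_comp (TV n m) g.toLin f.toLin) t.1

theorem GammaGK_isFinDim {X : GKModule.{u} n} (hX : IsAdmissible n X) (m : ℕ) :
    IsFinDim m ((GammaGK n m).obj X) := by
  have h := hX.finite_invariants (TV n m) (vKpow n m) (vKpow_contCoeff n m)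
  change Module.Finite ℂ (GammaSpace X m) at h
  let e : GammaSpace X m →ₗ[ℂ]
      (ModuleCat.restrictScalars (algebraMap ℂ (Hecke m))).obj ((GammaGK n m).obj X) :=
    { toFun := fun t => t
      map_add' := fun _ _ => rfl
      map_smul' := fun c t => by
        apply Subtype.ext
        change c • t.1 = gammaAct X m (algebraMap ℂ (Hecke m) c) t.1
        rw [AlgHom.commutes, Algebra.algebraMap_eq_smul_one, LinearMap.smul_apply,
          Module.End.one_apply] }
  exact Module.Finite.of_surjective e fun t => ⟨t, rfl⟩

/-- The functor `Γ_{n,m}` from Harish-Chandra modules to finite-dimensional `ℍ_m`-modules. -/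
def Gamma (n m : ℕ) : HCMod.{u} n ⥤ HeckeMod.{u} m :=
  (IsFinDim.{u} m).lift ((IsAdmissible.{u} n).ι ⋙ GammaGK n m) fun X =>
    GammaGK_isFinDim X.property m

/-- The isomorphism `V ⊗ V^{⊗m} ≅ V^{⊗(m+1)}`. -/
def consEquiv (n m : ℕ) : (Fin n → ℂ) ⊗[ℂ] TV n m ≃ₗ[ℂ] TV n (m + 1) :=
  TensorProduct.congr (PiTensorProduct.subsingletonEquiv (R := ℂ) (s := fun _ : Fin 1 => Fin n → ℂ) 0).symm
      (LinearEquiv.refl ℂ (TV n m)) ≪≫ₗ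
    TensorPower.mulEquiv ≪≫ₗ TensorPower.cast ℂ (Fin n → ℂ) (Nat.add_comm 1 m)

theorem consEquiv_tmul (m : ℕ) (v : Fin n → ℂ) (w : Fin m → Fin n → ℂ) :
    consEquiv n m (v ⊗ₜ PiTensorProduct.tprod ℂ w) =
      PiTensorProduct.tprod ℂ (Fin.cons v w : Fin (m + 1) → Fin n → ℂ) := by
  simp only [consEquiv, LinearEquiv.trans_apply, TensorProduct.congr_tmul,
    LinearEquiv.refl_apply, PiTensorProduct.subsingletonEquiv_symm_apply']
  rw [← TensorPower.gMul_def, TensorPower.tprod_mul_tprod, TensorPower.cast_tprod]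
  congr 1
  funext i
  induction i using Fin.cases with
  | zero => exact Fin.append_left (fun _ : Fin 1 => v) w 0
  | succ j =>
    have : Fin.cast (Nat.add_comm m 1) j.succ = Fin.natAdd 1 j := by
      apply Fin.ext
      simp [Nat.add_comm]
    rw [Function.comp_apply, this, Fin.append_right, Fin.cons_succ]

/-- The regrouping isomorphism `(X ⊗ V) ⊗ V^{⊗m} ≅ X ⊗ V^{⊗(m+1)}`. -/
def regroup (X : GKModule.{u} n) (m : ℕ) :
    X.tensorV ⊗[ℂ] TV n m ≃ₗ[ℂ] X ⊗[ℂ] TV n (m + 1) :=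
  TensorProduct.assoc ℂ X (Fin n → ℂ) (TV n m) ≪≫ₗ
    TensorProduct.congr (LinearEquiv.refl ℂ X) (consEquiv n m)

theorem regroup_tmul (X : GKModule.{u} n) (m : ℕ) (x : X) (v : Fin n → ℂ)
    (w : Fin m → Fin n → ℂ) :
    regroup X m ((show X.tensorV from x ⊗ₜ[ℂ] v) ⊗ₜ[ℂ] PiTensorProduct.tprod ℂ w) =
      x ⊗ₜ[ℂ] PiTensorProduct.tprod ℂ (Fin.cons v w : Fin (m + 1) → Fin n → ℂ) := by
  rw [← consEquiv_tmul]
  rfl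

end Gamma

end GLnHecke

end

universe u

open GLnHecke

/-! Write `Ω_{x,l}` for the Casimir tensor `∑ (0,E_{i,j})^{(x)} (0,E_{j,i})^{(l)}`. Both kinds of
generators of the Hecke algebra act by such tensors: `s_k` is `-Ω_{k,k+1}` and `y_l` is `∑_{x<l}
Ω_{x,l} + n/2`. The proof follows the tensors through the regrouping map from `(X ⊗ V) ⊗ V^{⊗m}` to
`X ⊗ V^{⊗(m+1)}`.

Regrouping splits the old factor `0`, which is `X ⊗ V`, into the new factors `0` and `1`, and
renumbers every old factor `l ≥ 1` as `l+1`. The Leibniz rule on `X ⊗ V` says that an element of the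
Lie algebra acting on the old factor `0` acts on the new factors `0` and `1` and the results are
added (`regroup_slot_zero`). Hence `Ω_{0,l}` turns into `Ω_{0,l+1} + Ω_{1,l+1}`
(`regroup_casimir_zero`), while `Ω_{k,l}` with `k, l ≥ 1` turns into `Ω_{k+1,l+1}`
(`regroup_casimir_succ`).

Consequently `∑_{x<l} Ω_{x,l}`, with `l` terms, becomes the full sum of `l+1` terms that occurs in
`y_{l+1}`. The constant `n/2` depends on `n` only and is unchanged, so `y_l` goes to `y_{l+1}`
(`regroup_y`). No `s_k` touches factor `0`, so `s_k` goes to `s_{k+1}` (`regroup_s`). This is the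
homomorphism that defines the restriction functor, and agreement on generators extends to the whole
algebra (`regroup_gammaAct`).

The group `K` acts diagonally on both sides, so regrouping is `K`-equivariant and, being bijective,
matches the fixed vectors (`regroup_gammaK`, `map_regroup_GammaSpace`). A morphism `f` acts on `X`
alone, which gives naturality (`regroup_natural`). -/

namespace GLnHecke

variable {n : ℕ}

/-! ### Pure tensors in `(X ⊗ V) ⊗ V^{⊗m}` -/

/-- The pure tensor `x ⊗ v` as an element of the `(𝔤, K)`-module `X ⊗ V`. -/
noncomputable def tmulV {X : GKModule.{u} n} (x : X) (v : Fin n → ℂ) : X.tensorV := x ⊗ₜ[ℂ] v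

/-- Pure tensors span at each of the three levels `X ⊗ V`, `V^{⊗m}` and their product. Phrasing the
test with `tmulV` keeps the first factor typed as the module `X.tensorV`, so that lemmas about a
general `(𝔤, K)`-module still apply to it. -/
theorem tensorV_ext {X : GKModule.{u} n} {Y : Type*} [AddCommGroup Y] [Module ℂ Y] {m : ℕ}
    {f g : X.tensorV ⊗[ℂ] TV n m →ₗ[ℂ] Y}
    (h : ∀ (x : X) (v : Fin n → ℂ) (w : Fin m → Fin n → ℂ),
      f (tmulV x v ⊗ₜ[ℂ] PiTensorProduct.tprod ℂ w) =
        g (tmulV x v ⊗ₜ[ℂ] PiTensorProduct.tprod ℂ w)) :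
    f = g := by
  apply TensorProduct.ext
  -- The carrier of `X.tensorV` is a tensor product only after unfolding, so its two factors are
  -- named explicitly.
  refine TensorProduct.ext' (M := X) (N := Fin n → ℂ) fun x v => ?_
  apply PiTensorProduct.ext
  exact MultilinearMap.ext fun w => h x v w

/-- A form of `regroup_tmul` that rewriting recognises once vectors are written with `tmulV`. The
split-off vector enters at the head of the list, which is the source of every index shift below. -/
theorem regroup_tmulV (X : GKModule.{u} n) (m : ℕ) (x : X) (v : Fin n → ℂ)
    (w : Fin m → Fin n → ℂ) :
    regroup X m (tmulV x v ⊗ₜ[ℂ] PiTensorProduct.tprod ℂ w) =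
      x ⊗ₜ[ℂ] PiTensorProduct.tprod ℂ (Fin.cons v w : Fin (m + 1) → Fin n → ℂ) :=
  regroup_tmul X m x v w

/-! ### Regrouping and the action on a single factor -/

/-- The Lie algebra acts on the first factor `X ⊗ V` through the factors `X` and `V`. -/
theorem regroup_slot_zero (X : GKModule.{u} n) (m : ℕ) (E : Mat n) :
    (regroup X m).toLinearMap ∘ₗ slot X.tensorV m 0 E =
      (slot X (m + 1) 0 E + slot X (m + 1) 1 E) ∘ₗ (regroup X m).toLinearMap := by
  apply tensorV_ext
  intro x v w
  -- The Leibniz rule; its two summands become the actions on the new factors `0` and `1`.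
  have h : X.tensorV.ρg (phiR E) (tmulV x v) =
      tmulV (X.ρg (phiR E) x) v + tmulV x (vg n (phiR E) v) := X.tensorg_tmul _ _ _
  -- Factor `1` is the successor of position `0` in `V^{⊗(m+1)}`; in this form `slot_succ_tmul` can
  -- fire.
  rw [← Fin.succ_zero_eq_one]
  simp only [LinearMap.comp_apply, LinearEquiv.coe_coe, slot_zero_tmul, h,
    TensorProduct.add_tmul, map_add, regroup_tmulV, LinearMap.add_apply, slot_succ_tmul,
    onFactor_tprod, Fin.cons_zero, Fin.update_cons_zero]

/-- Changing an entry of the tail and then prepending `v` is the same as prepending `v` and changing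
the entry one place further on. -/
theorem regroup_slot_succ (X : GKModule.{u} n) (m : ℕ) (l : Fin m) (E : Mat n) :
    (regroup X m).toLinearMap ∘ₗ slot X.tensorV m l.succ E =
      slot X (m + 1) l.succ.succ E ∘ₗ (regroup X m).toLinearMap := by
  apply tensorV_ext
  intro x v w
  simp only [LinearMap.comp_apply, LinearEquiv.coe_coe, regroup_tmulV, slot_succ_tmul,
    onFactor_tprod, Fin.cons_succ, Fin.cons_update]

/-! ### Regrouping and Casimir tensors -/

/-- The Casimir tensor is linear in its first leg, so the coproduct on that leg gives the familiar
`(Δ ⊗ 1)Ω = Ω_{13} + Ω_{23}`. The second summand supplies the one extra term that the shifted `y`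
has. -/
theorem regroup_casimir_zero (X : GKModule.{u} n) (m : ℕ) (l : Fin m)
    (t : X.tensorV ⊗[ℂ] TV n m) :
    regroup X m (casimir (slot X.tensorV m 0) (slot X.tensorV m l.succ) t) =
      casimir (slot X (m + 1) 0) (slot X (m + 1) l.succ.succ) (regroup X m t) +
        casimir (slot X (m + 1) 1) (slot X (m + 1) l.succ.succ) (regroup X m t) := by
  have h0 : ∀ E s, regroup X m (slot X.tensorV m 0 E s) = slot X (m + 1) 0 E (regroup X m s) +
      slot X (m + 1) 1 E (regroup X m s) := fun E => LinearMap.congr_fun (regroup_slot_zero X m E)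
  have h1 : ∀ E s, regroup X m (slot X.tensorV m l.succ E s) =
      slot X (m + 1) l.succ.succ E (regroup X m s) :=
    fun E => LinearMap.congr_fun (regroup_slot_succ X m l E)
  simp only [casimir, LinearMap.sum_apply, map_sum, Module.End.mul_apply, h0, h1,
    Finset.sum_add_distrib]

theorem regroup_casimir_succ (X : GKModule.{u} n) (m : ℕ) (k l : Fin m)
    (t : X.tensorV ⊗[ℂ] TV n m) :
    regroup X m (casimir (slot X.tensorV m k.succ) (slot X.tensorV m l.succ) t) =
      casimir (slot X (m + 1) k.succ.succ) (slot X (m + 1) l.succ.succ) (regroup X m t) := by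
  have h1 : ∀ (l : Fin m) E s, regroup X m (slot X.tensorV m l.succ E s) =
      slot X (m + 1) l.succ.succ E (regroup X m s) :=
    fun l E => LinearMap.congr_fun (regroup_slot_succ X m l E)
  simp only [casimir, LinearMap.sum_apply, map_sum, Module.End.mul_apply, h1]

/-! ### Generators of the Hecke algebra -/

/-- Separates factor `0`, the only one that regrouping splits, from the factors that are merely
renumbered. -/
theorem sum_Iio_succ {M : Type*} [AddCommMonoid M] {m : ℕ} (l : Fin m) (f : Fin (m + 1) → M) :
    ∑ x ∈ Finset.Iio l.succ, f x = f 0 + ∑ x ∈ Finset.Iio l, f x.succ := by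
  have h : Finset.Iio l.succ = insert 0 ((Finset.Iio l).map (Fin.succEmb m)) := by
    ext x
    induction x using Fin.cases <;> simp
  rw [h, Finset.sum_insert (by simp), Finset.sum_map]
  rfl

/-- The zeroth term of the left sum yields the terms with index `0` and `1` of the right sum, and
the remaining terms correspond one to one. -/
theorem regroup_y (X : GKModule.{u} n) (m : ℕ) (l : Fin m) (t : X.tensorV ⊗[ℂ] TV n m) :
    regroup X m ((gammaDatum X.tensorV m).y l t) =
      (gammaDatum X (m + 1)).y l.succ (regroup X m t) := by
  change regroup X m ((∑ x ∈ Finset.Iio l.succ,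
      casimir (slot X.tensorV m x) (slot X.tensorV m l.succ) +
        ((n : ℂ) / 2) • 1 : Module.End ℂ _) t) =
    (∑ x ∈ Finset.Iio l.succ.succ, casimir (slot X (m + 1) x) (slot X (m + 1) l.succ.succ) +
      ((n : ℂ) / 2) • 1 : Module.End ℂ _) (regroup X m t)
  -- `sum_Iio_succ` acts once on the left, removing factor `0`, and twice on the right, removing
  -- factors `0` and `1`. What is left on both sides is a sum over `Finset.Iio l`.
  simp only [sum_Iio_succ, LinearMap.add_apply, LinearMap.sum_apply, map_add, map_sum,
    regroup_casimir_zero, regroup_casimir_succ, LinearMap.smul_apply, map_smul,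
    Module.End.one_apply, Fin.succ_zero_eq_one, add_assoc]

/-- Both factors involved have number at least `1`, so nothing is split and only the renumbering
remains. -/
theorem regroup_s (X : GKModule.{u} n) (m i : ℕ) (hi : i + 1 < m)
    (t : X.tensorV ⊗[ℂ] TV n m) :
    regroup X m ((gammaDatum X.tensorV m).s i hi t) =
      (gammaDatum X (m + 1)).s (i + 1) (Nat.succ_lt_succ hi) (regroup X m t) := by
  have e : ∀ (Y : GKModule.{u} n) (r j : ℕ) (hj : j + 1 < r), (gammaDatum Y r).s j hj =
      -casimir (slot Y r (Fin.succ ⟨j, Nat.lt_of_succ_lt hj⟩)) (slot Y r (Fin.succ ⟨j + 1, hj⟩)) :=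
    fun _ _ _ _ => rfl
  rw [e, e, LinearMap.neg_apply, LinearMap.neg_apply, map_neg, regroup_casimir_succ]
  rfl

theorem shift_y {m : ℕ} (i : Fin m) : Hecke.shift m (Hecke.y i) = Hecke.y i.succ :=
  HeckeDatum.lift_y _ i

theorem shift_s {m : ℕ} (i : ℕ) (hi : i + 1 < m) :
    Hecke.shift m (Hecke.s i hi) = Hecke.s (i + 1) (Nat.succ_lt_succ hi) :=
  HeckeDatum.lift_s _ i hi

/-- The regrouping isomorphism intertwines the actions of `ℍ_m`. -/
theorem regroup_gammaAct (X : GKModule.{u} n) (m : ℕ) (h : Hecke m)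
    (t : X.tensorV ⊗[ℂ] TV n m) :
    regroup X m (gammaAct X.tensorV m h t) =
      gammaAct X (m + 1) (Hecke.shift m h) (regroup X m t) := by
  obtain ⟨a, rfl⟩ := Hecke.mk_surjective m h
  -- The vector stays general because, for a product `a * b`, the hypothesis on `a` is applied to
  -- the image of `t` under `b`.
  induction a using FreeAlgebra.induction generalizing t with
  | grade0 c => simp [Algebra.algebraMap_eq_smul_one]
  | grade1 g =>
    cases g with
    | y l =>
      change regroup X m (gammaAct X.tensorV m (Hecke.y l) t) =
        gammaAct X (m + 1) (Hecke.shift m (Hecke.y l)) _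
      rw [shift_y, gammaAct, gammaAct, HeckeDatum.lift_y, HeckeDatum.lift_y, regroup_y]
    | s i hi =>
      change regroup X m (gammaAct X.tensorV m (Hecke.s i hi) t) =
        gammaAct X (m + 1) (Hecke.shift m (Hecke.s i hi)) _
      rw [shift_s, gammaAct, gammaAct, HeckeDatum.lift_s, HeckeDatum.lift_s, regroup_s]
  | mul a b ha hb => simp only [map_mul, Module.End.mul_apply, ha, hb]
  | add a b ha hb => simp only [map_add, LinearMap.add_apply, ha, hb]

/-! ### `K`-fixed vectors -/

/-- The action of `K` on `X ⊗ V` is itself diagonal, so on either side each factor is acted on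
separately and the bracketing does not matter. -/
theorem regroup_gammaK (X : GKModule.{u} n) (m : ℕ) (k : UK n) (t : X.tensorV ⊗[ℂ] TV n m) :
    regroup X m (gammaK X.tensorV m k t) = gammaK X (m + 1) k (regroup X m t) := by
  suffices h : (regroup X m).toLinearMap ∘ₗ gammaK X.tensorV m k =
      gammaK X (m + 1) k ∘ₗ (regroup X m).toLinearMap from LinearMap.congr_fun h t
  apply tensorV_ext
  intro x v w
  have h : X.tensorV.ρK k (tmulV x v) = tmulV (X.ρK k x) (vK n k v) := rfl
  simp only [LinearMap.comp_apply, LinearEquiv.coe_coe, gammaK_tmul, h, vKpow_tprod,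
    regroup_tmulV]
  -- Only the lists of vectors of `V` remain to be compared: the head, then each entry of the tail.
  refine congrArg (fun u => X.ρK k x ⊗ₜ[ℂ] PiTensorProduct.tprod ℂ u) (funext fun i => ?_)
  induction i using Fin.cases with
  | zero => rfl
  | succ j => rfl

/-- For each `k`, equivariance carries the equation `k t = t` across, and injectivity carries it
back. -/
theorem regroup_mem_GammaSpace_iff (X : GKModule.{u} n) (m : ℕ)
    (t : X.tensorV ⊗[ℂ] TV n m) :
    regroup X m t ∈ GammaSpace X (m + 1) ↔ t ∈ GammaSpace X.tensorV m := by
  refine forall_congr' fun k => ?_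
  rw [← regroup_gammaK, (regroup X m).injective.eq_iff]

theorem map_regroup_GammaSpace (X : GKModule.{u} n) (m : ℕ) :
    (GammaSpace X.tensorV m).map (regroup X m).toLinearMap = GammaSpace X (m + 1) := by
  ext s
  constructor
  · rintro ⟨t, ht, rfl⟩
    exact (regroup_mem_GammaSpace_iff X m t).mpr ht
  · intro hs
    refine ⟨(regroup X m).symm s, ?_, (regroup X m).apply_symm_apply s⟩
    exact (regroup_mem_GammaSpace_iff X m _).mp (by rwa [LinearEquiv.apply_symm_apply])

/-! ### Naturality and the isomorphism of functors -/

/-- The morphism changes only the `X`-component, and regrouping leaves that component alone. -/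
theorem regroup_natural {X Y : GKModule.{u} n} (f : X ⟶ Y) (m : ℕ)
    (t : X.tensorV ⊗[ℂ] TV n m) :
    regroup Y m (((tensorVGK n).map f).toLin.rTensor (TV n m) t) =
      f.toLin.rTensor (TV n (m + 1)) (regroup X m t) := by
  suffices h : (regroup Y m).toLinearMap ∘ₗ ((tensorVGK n).map f).toLin.rTensor (TV n m) =
      f.toLin.rTensor (TV n (m + 1)) ∘ₗ (regroup X m).toLinearMap from LinearMap.congr_fun h t
  apply tensorV_ext
  intro x v w
  have h : ((tensorVGK n).map f).toLin (tmulV x v) = (tmulV (f.toLin x) v : Y.tensorV) := rfl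
  simp only [LinearMap.comp_apply, LinearEquiv.coe_coe, LinearMap.rTensor_tmul, regroup_tmulV]
  -- The two sides of `h` are typed in `(tensorVGK n).obj Y` and `Y.tensorV`, which agree by
  -- unfolding; `congrArg` fixes the second reading.
  exact (congrArg (fun z : Y.tensorV => regroup Y m (z ⊗ₜ[ℂ] PiTensorProduct.tprod ℂ w)) h).trans
    (regroup_tmulV Y m _ _ _)

/-- The regrouping isomorphism on `K`-fixed vectors, as an isomorphism of `ℍ_m`-modules. -/
noncomputable def gammaRegroup (X : GKModule.{u} n) (m : ℕ) :
    GammaSpace X.tensorV m ≃ₗ[Hecke m]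
      (ModuleCat.restrictScalars (Hecke.shift m).toRingHom).obj ((GammaGK n (m + 1)).obj X) where
  toFun t := (⟨regroup X m t.1, (regroup_mem_GammaSpace_iff X m t.1).mpr t.2⟩ :
    GammaSpace X (m + 1))
  map_add' s t := Subtype.ext (map_add (regroup X m) s.1 t.1)
  -- On the target, `h` acts through `Hecke.shift m h` by the definition of restriction of scalars,
  -- so linearity is exactly `regroup_gammaAct`.
  map_smul' h t := Subtype.ext (regroup_gammaAct X m h t.1)
  invFun := fun s : GammaSpace X (m + 1) => ⟨(regroup X m).symm s.1,
    (regroup_mem_GammaSpace_iff X m _).mp (by rw [LinearEquiv.apply_symm_apply]; exact s.2)⟩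
  left_inv t := Subtype.ext ((regroup X m).symm_apply_apply t.1)
  right_inv s := Subtype.ext ((regroup X m).apply_symm_apply _)

/-- The natural isomorphism `Γ_{n,m} ∘ (- ⊗ V) ≅ For ∘ Γ_{n,m+1}`. -/
noncomputable def gammaTensorIso (n m : ℕ) :
    tensorV.{u} n ⋙ Gamma n m ≅ Gamma n (m + 1) ⋙ restrictShift m :=
  NatIso.ofComponents
    -- Finite-dimensional modules form a full subcategory, so an isomorphism of the underlying
    -- modules suffices.
    (fun X => ObjectProperty.isoMk _ (gammaRegroup X.obj m).toModuleIso)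
    (by
      intro X Y f
      apply ObjectProperty.hom_ext
      apply ModuleCat.hom_ext
      apply LinearMap.ext
      intro t
      apply Subtype.ext
      exact regroup_natural f.hom m t.1)

end GLnHecke

/-- Here `m` stands for the `m - 1` of the informal statement, which absorbs the condition `m ≥ 1`.
The last clause ties `η` to the regrouping map, so that it is the canonical identification and not
just some isomorphism. -/
theorem mainTheorem7 (n m : ℕ) (lamL lamR : Fin n → ℂ) :
    (∀ X : HClam.{u} lamL lamR,
      (GammaSpace X.obj.tensorV m).map (regroup X.obj m).toLinearMap =
          GammaSpace X.obj (m + 1) ∧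
        ∀ (h : Hecke m) (t : GammaSpace X.obj.tensorV m) (t' : GammaSpace X.obj (m + 1)),
          (t' : X.obj ⊗[ℂ] TV n (m + 1)) = regroup X.obj m t →
            ((Hecke.shift m h • t' : GammaSpace X.obj (m + 1)) : X.obj ⊗[ℂ] TV n (m + 1)) =
              regroup X.obj m (h • t : GammaSpace X.obj.tensorV m)) ∧
    ∃ η : HClam.incl.{u} lamL lamR ⋙ tensorV n ⋙ Gamma n m ≅
        HClam.incl.{u} lamL lamR ⋙ Gamma n (m + 1) ⋙ restrictShift m,
      ∀ (X : HClam.{u} lamL lamR) (t : GammaSpace X.obj.tensorV m),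
        (GammaSpace X.obj (m + 1)).subtype ((η.hom.app X).hom.hom t) =
          regroup X.obj m t := by
  refine ⟨fun X => ⟨map_regroup_GammaSpace X.obj m, ?_⟩,
    -- The isomorphism exists on all Harish-Chandra modules and is restricted to `ℋ𝒞_λ` along the
    -- inclusion.
    Functor.isoWhiskerLeft (HClam.incl lamL lamR) (gammaTensorIso n m), ?_⟩
  · intro h t t' ht
    rw [gamma_smul_coe, gamma_smul_coe, ht, regroup_gammaAct]
  · intro X t
    rfl
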